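/- Let $k$ be a field, $R=k[x_0,\ldots,x_n]$ with its standard grading, let $1\le c<s$ be integers, and let $F_1,\ldots,F_s\in R$ be forms of the same degree $\delta$ such that any $c+1$ of them form a regular sequence. Let $I_c=\bigcap_{1\le j_1<\cdots<j_c\le s}(F_{j_1},\ldots,F_{j_c})$, and for $m\ge 1$ let $I_c^{(m)}=\bigcap_{P\in \mathrm{Ass}(R/I_c)}(I_c^mR_P\cap R)$ be its $m$-th symbolic power. Let $\beta_{i,j}(R/I_c^{(m)})$ denote the number of summands $R(-j)$ in homological degree $i$ of a minimal graded free resolution of $R/I_c^{(m)}$. Fix $m>1$ and write $m=qc+r$ with integers $q\ge 0$ and $1\le r\le c$. Let $\mathcal P_{\le c}(m)$ be the set of partitions $[\underline d]=[d_1,\ldots,d_t]$ of $m$ with $c\ge d_1\ge\cdots\ge d_t\ge 1$; $t$ is the length of $[\underline d]$. Write $[\underline b]>_{\rm alex}[\underline d]$ if $[\underline b]$ is shorter than $[\underline d]$, or they have the same length and $[\underline b]$ is lexicographically larger. The largest partition for this order is $[c,\ldots,c,r]$ (with $q$ entries $c$ followed by $r$). For every other $[\underline d]\in\mathcal P_{\le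 c}(m)$ let $$i_0=i_0([\underline d])=\max\{j\ge 1 \mid \exists\,[\underline b]\in\mathcal P_{\le c}(m),\ [\underline b]>_{\rm alex}[\underline d],\ b_h=d_h \text{ for } 1\le h\le j-1\}$$ be its index of overlap, and put $$B([\underline d])=\binom{s}{s-c+d_1}\binom{s-c+d_1}{s-c+d_2}\cdots\binom{s-c+d_{i_0-1}}{s-c+d_{i_0}},\qquad A_{i-1}([\underline d])=\sum_{j=0}^{d_{i_0}-d_t}\binom{c-d_{i_0}+j}{i-1}\binom{s-c+d_t+j-1}{j}.$$ Then for all integers $1\le i\le c$ and $\lceil m/c\rceil\le t\le m$, with $j_i=\delta(t(s-c)+m+i-1)$, $$\beta_{i,j_i}(R/I_c^{(m)})=\sum_{d_t=d_{i_0}}\binom{c-d_{i_0}}{i-1}B([\underline d])+\sum_{d_t<d_{i_0}}B([\underline d])\,A_{i-1}([\underline d])+\epsilon_t\binom{s}{c-r+1-i}\binom{s-c+r+i-2}{i-1},$$ where both sums run over the partitions $[\underline d]\in\mathcal P_{\le c}(m)$ of length $t$ different from $[c,\ldots,c,r]$ that satisfy the indicated condition, $\epsilon_t=1$ if $t=\lceil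 m/c\rceil$ and $\epsilon_t=0$ otherwise, and a binomial coefficient with negative lower entry is $0$. -/

import Mathlib

namespace StarConfiguration

noncomputable section

/-- The `m`-th symbolic power `I^(m) = ⋂_{P ∈ Ass(R/I)} (I^m R_P ∩ R)` of an ideal `I`. -/
def symbolicPower {R : Type*} [CommRing R] (I : Ideal R) (m : ℕ) : Ideal R :=
  ⨅ P : {P : Ideal R // P ∈ associatedPrimes R (R ⧸ I)},
    haveI : P.1.IsPrime := P.2.isPrime
    ((I ^ m).map (algebraMap R (Localization.AtPrime P.1))).comap
      (algebraMap R (Localization.AtPrime P.1))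

/-- The ideal `I_{c,F}`: the intersection of the ideals generated by `c` of the elements
`F_1, …, F_s`. -/
def starIdeal {R : Type*} [CommRing R] {s : ℕ} (c : ℕ) (F : Fin s → R) : Ideal R :=
  ⨅ S : {S : Finset (Fin s) // S.card = c}, Ideal.span (F '' (S.1 : Set (Fin s)))

/-- A minimal graded free resolution
`⋯ → ⨁_a R(-deg 1 a) → ⨁_a R(-deg 0 a) → R/J → 0` of `R/J` over a standard graded polynomial
ring `R = k[x_σ]`. The module in homological degree `p` has the basis
`Pi.single a 1`, `a : Fin (rank p)`, with `Pi.single a 1` in degree `deg p a`. -/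
structure MinimalGradedFreeResolution {σ k : Type*} [Field k]
    (J : Ideal (MvPolynomial σ k)) where
  rank : ℕ → ℕ
  deg : (p : ℕ) → Fin (rank p) → ℕ
  d : (p : ℕ) →
    (Fin (rank (p + 1)) → MvPolynomial σ k) →ₗ[MvPolynomial σ k]
      (Fin (rank p) → MvPolynomial σ k)
  aug : (Fin (rank 0) → MvPolynomial σ k) →ₗ[MvPolynomial σ k] (MvPolynomial σ k ⧸ J)
  /-- The differentials preserve degrees. -/
  d_homogeneous : ∀ p a b, d p (Pi.single a 1) b = 0 ∨
    ∃ e, deg p b + e = deg (p + 1) a ∧ (d p (Pi.single a 1) b).IsHomogeneous e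
  /-- The augmentation preserves degrees. -/
  aug_homogeneous : ∀ a, ∃ f : MvPolynomial σ k,
    f.IsHomogeneous (deg 0 a) ∧ aug (Pi.single a 1) = Ideal.Quotient.mk J f
  aug_surjective : Function.Surjective aug
  exact_zero : Function.Exact (d 0) aug
  exact_succ : ∀ p, Function.Exact (d (p + 1)) (d p)
  /-- Minimality: all entries of the differentials lie in the irrelevant maximal ideal. -/
  minimal : ∀ p a b, MvPolynomial.constantCoeff (d p (Pi.single a 1) b) = 0

/-- The number of summands `R(-j)` in homological degree `i`. -/
def MinimalGradedFreeResolution.betti {σ k : Type*} [Field k] {J : Ideal (MvPolynomial σ k)}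
    (G : MinimalGradedFreeResolution J) (i j : ℕ) : ℕ :=
  (Finset.univ.filter fun a : Fin (G.rank i) => G.deg i a = j).card

/-- The entries `[d_1, …, d_t]` of a partition, in non-increasing order. -/
def entries {m : ℕ} (p : m.Partition) : List ℕ := p.parts.sort (· ≥ ·)

/-- The set `P_{≤ c}(m)` of partitions of `m` with all entries at most `c`. -/
def partitionsLE (c m : ℕ) : Finset m.Partition :=
  Finset.univ.filter fun p => ∀ x ∈ p.parts, x ≤ c

/-- The order `b >_alex d`: either `b` is shorter, or both have the same length and `b` is
lexicographically larger. -/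
def AlexGT (b d : List ℕ) : Prop :=
  b.length < d.length ∨ (b.length = d.length ∧ List.Lex (· < ·) d b)

/-- The entry `d_h`, counted from `h = 1`, with the value `d_0 = c`, so that
`s - c + d_0 = s`. -/
def entry (c : ℕ) (d : List ℕ) (h : ℕ) : ℕ := (c :: d).getD h 0

/-- The index of overlap of a partition in `P_{≤ c}(m)` with respect to `>_alex`. For a partition
that is not the largest one, this is the supremum of a non-empty bounded set. -/
def overlapIndex (c : ℕ) {m : ℕ} (p : m.Partition) : ℕ :=
  sSup {j : ℕ | 1 ≤ j ∧ ∃ b ∈ partitionsLE c m, AlexGT (entries b) (entries p) ∧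
    ∀ h, 1 ≤ h → h ≤ j - 1 → entry c (entries p) h = entry c (entries b) h}

/-- The product `C(s, s-c+d_1) C(s-c+d_1, s-c+d_2) ⋯ C(s-c+d_{i₀-1}, s-c+d_{i₀})`. -/
def chainProd (s c : ℕ) (d : List ℕ) (i₀ : ℕ) : ℕ :=
  ∏ h ∈ Finset.Icc 1 i₀, (s - c + entry c d (h - 1)).choose (s - c + entry c d h)

/-- `A_{i-1}([d]) = ∑_{j=0}^{d_{i₀}-d_t} C(c-d_{i₀}+j, i-1) C(s-c+d_t+j-1, j)`. -/
def Acoeff (s c i : ℕ) (d : List ℕ) (i₀ : ℕ) : ℕ :=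
  ∑ j ∈ Finset.range (entry c d i₀ - entry c d d.length + 1),
    (c - entry c d i₀ + j).choose (i - 1) *
      (s - c + entry c d d.length + j - 1).choose j

/-- The partitions in `P_{≤ c}(m)` of length `t` other than `[c, …, c, r]`, where `m = q c + r`. -/
def nonmaximalPartitions (c m q r t : ℕ) : Finset m.Partition :=
  (partitionsLE c m).filter fun p =>
    (entries p).length = t ∧ entries p ≠ List.replicate q c ++ [r]

/-- The term `C(s, c-r+1-i) C(s-c+r+i-2, i-1)`; the first factor is zero if `c-r+1-i < 0`. -/
def topTerm (s c r i : ℕ) : ℕ :=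
  if i ≤ c - r + 1 then (s.choose (c - r + 1 - i)) * (s - c + r + i - 2).choose (i - 1) else 0

end

end StarConfiguration

/-! The forms `F i` behave like variables as long as at most `c + 1` of them interact, so the
problem is reduced to monomials in the `F i`.

The symbolic power is the intersection of the ideals `(F_i : i ∈ S)^m` over all `c`-subsets `S`
(`symbolicPower_starIdeal`, `iInf_span_pow_eq`), and this is generated by the monomials whose
exponents sum to at least `m` over every `c`-subset. The minimal such exponent vectors `a`, with
maximum `t = topExp a`, are those of total degree `m + t(s - c)` that attain `t` in at least `s - c
+ 1` positions.

Ordered by maximum, then by sum of squares, then lexicographically, these generators have linear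
quotients: the colon of the earlier ones by `a` is `(F_i : i ∈ linSet a)` (`mem_span_linSet_iff`).
One inclusion is an exchange argument, the other a convexity argument together with cancellation
modulo pure powers of the `F i`. Since `linSet a` has at most `c - 1` elements, each colon ideal is
a complete intersection. Iterated mapping cones (`exists_cone`) give a resolution, minimal for
degree reasons, in which `a` contributes `C(|linSet a|, i - 1)` to homological degree `i`.
Comparison of resolutions (`betti_eq`) carries the numbers to any minimal resolution. The same
filtration supplies the depth statement behind the description of the symbolic power.

It remains to count. The level sets `{i | h ≤ a i}` of a generator have sizes `s - c + d_h` for a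
partition `d` of `m` with parts at most `c`, whose length is `t`. Choosing the level sets
successively produces the product of binomials, and the last choice, weighted by `|linSet a|`,
produces the sum `A_{i-1}` (`sum_typeSet_choose`). This gives the formula with `t - 1` in place of
the index of overlap. The two agree because the entries from that index up to position `t - 1` are
equal (`overlapIndex_spec`). The largest partition has a closed form (`maximal_term`). -/

namespace StarConfiguration

open MvPolynomial

attribute [local instance] MvPolynomial.gradedAlgebra

/-! ### Homogeneous vectors in graded free modules. -/

section Homogeneous

variable {σ k : Type*} [Field k]

theorem homogeneousComponent_mul_of_isHomogeneous {p q : MvPolynomial σ k} {e n : ℕ}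
    (hq : q.IsHomogeneous e) :
    homogeneousComponent n (p * q) =
      if e ≤ n then homogeneousComponent (n - e) p * q else 0 := by
  have h := DirectSum.coe_decompose_mul_of_right_mem (homogeneousSubmodule σ k) (a := p) n
    ((mem_homogeneousSubmodule e q).2 hq)
  have key : ∀ (r : MvPolynomial σ k) (i : ℕ),
      ((DirectSum.decompose (homogeneousSubmodule σ k) r i : homogeneousSubmodule σ k i) :
        MvPolynomial σ k) = homogeneousComponent i r :=
    fun r i => decomposition.decompose'_apply r i
  rw [key, key] at h
  exact h

/-- The vector `x` is homogeneous of degree `D` in the graded free module whose `b`-th basis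
vector has degree `deg b`. -/
def IsHomVec {ι : Type*} (deg : ι → ℕ) (D : ℕ) (x : ι → MvPolynomial σ k) : Prop :=
  ∀ b, x b = 0 ∨ ∃ e, deg b + e = D ∧ (x b).IsHomogeneous e

/-- The homogeneous component of degree `D` of a vector in a graded free module. -/
noncomputable def homComp {ι : Type*} (deg : ι → ℕ) (D : ℕ) (x : ι → MvPolynomial σ k) :
    ι → MvPolynomial σ k :=
  fun b => if deg b ≤ D then homogeneousComponent (D - deg b) (x b) else 0

variable {ι κ : Type*} {deg : ι → ℕ} {deg' : κ → ℕ} {D : ℕ}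

theorem isHomVec_homComp (x : ι → MvPolynomial σ k) : IsHomVec deg D (homComp deg D x) := by
  intro b
  unfold homComp
  split_ifs with h
  · exact Or.inr ⟨D - deg b, by omega, homogeneousComponent_isHomogeneous _ _⟩
  · exact Or.inl rfl

theorem IsHomVec.homComp_eq {x : ι → MvPolynomial σ k} (hx : IsHomVec deg D x) :
    homComp deg D x = x := by
  funext b
  unfold homComp
  rcases hx b with h | ⟨e, he, h⟩
  · simp [h]
  · rw [if_pos (by omega), show D - deg b = e by omega]
    exact homogeneousComponent_eq_self h

theorem linearMap_apply_eq_sum {R M : Type*} [CommRing R] [AddCommGroup M] [Module R M]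
    [Fintype ι] [DecidableEq ι] (f : (ι → R) →ₗ[R] M) (x : ι → R) :
    f x = ∑ a, x a • f (Pi.single a 1) :=
  LinearMap.pi_apply_eq_sum_univ f x |>.trans <| by
    refine Finset.sum_congr rfl fun a _ => ?_
    congr 2
    funext b
    simp [Pi.single_apply, eq_comm]

variable [Fintype ι] [DecidableEq ι]

theorem map_homComp (f : (ι → MvPolynomial σ k) →ₗ[MvPolynomial σ k] (κ → MvPolynomial σ k))
    (hf : ∀ a, IsHomVec deg' (deg a) (f (Pi.single a 1))) (x : ι → MvPolynomial σ k) :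
    f (homComp deg D x) = homComp deg' D (f x) := by
  funext b
  rw [linearMap_apply_eq_sum f, linearMap_apply_eq_sum f x]
  -- For fixed `b` the component is a `k`-linear function of `y b`, so it passes through the sum
  -- over basis vectors.
  have hlin : ∀ y : κ → MvPolynomial σ k, homComp deg' D y b =
      (if deg' b ≤ D then homogeneousComponent (D - deg' b) else 0 :
        MvPolynomial σ k →ₗ[k] MvPolynomial σ k) (y b) := by
    intro y; unfold homComp; split_ifs <;> rfl
  rw [hlin]
  simp only [Finset.sum_apply, Pi.smul_apply, smul_eq_mul, map_sum]
  refine Finset.sum_congr rfl fun a _ => ?_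
  rcases hf a b with h | ⟨e, he, h⟩
  · simp [h]
  · by_cases h1 : deg' b ≤ D
    · rw [if_pos h1, homogeneousComponent_mul_of_isHomogeneous h]
      unfold homComp
      by_cases h2 : deg a ≤ D
      · rw [if_pos h2, if_pos (by omega), show D - deg' b - e = D - deg a by omega]
      · rw [if_neg h2, if_neg (by omega), zero_mul]
    · rw [if_neg h1]
      unfold homComp
      rw [if_neg (by omega)]
      simp

/-- Any preimage becomes homogeneous on passing to its component of degree `D`, whose image is the
component of `y`, that is `y` itself. This makes lifts along exact sequences graded. -/
theorem IsHomVec.exists_preimage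
    {f : (ι → MvPolynomial σ k) →ₗ[MvPolynomial σ k] (κ → MvPolynomial σ k)}
    (hf : ∀ a, IsHomVec deg' (deg a) (f (Pi.single a 1))) {y : κ → MvPolynomial σ k}
    (hy : IsHomVec deg' D y) (h : y ∈ LinearMap.range f) :
    ∃ x, IsHomVec deg D x ∧ f x = y := by
  obtain ⟨x, rfl⟩ := h
  exact ⟨homComp deg D x, isHomVec_homComp x, by rw [map_homComp f hf, hy.homComp_eq]⟩

theorem IsHomVec.map {c : ℕ}
    {f : (ι → MvPolynomial σ k) →ₗ[MvPolynomial σ k] (κ → MvPolynomial σ k)}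
    (hf : ∀ a, IsHomVec deg' (deg a + c) (f (Pi.single a 1))) {x : ι → MvPolynomial σ k}
    (hx : IsHomVec deg D x) : IsHomVec deg' (D + c) (f x) := by
  -- Shifting the degrees of the source by `c` makes `f` degree preserving.
  have h := map_homComp (deg := fun a => deg a + c) (deg' := deg') (D := D + c) f hf x
  have hx' : IsHomVec (fun a => deg a + c) (D + c) x := fun b =>
    (hx b).imp id fun ⟨e, he, h⟩ => ⟨e, by dsimp only; omega, h⟩
  rw [hx'.homComp_eq] at h
  rw [h]
  exact isHomVec_homComp _

end Homogeneous

namespace MinimalGradedFreeResolution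

/-! ### Comparison of resolutions and uniqueness of graded Betti numbers. -/

section Lift

variable {σ k : Type*} [Field k] {J K : Ideal (MvPolynomial σ k)}

theorem d_isHomVec (A : MinimalGradedFreeResolution J) (p : ℕ) (a : Fin (A.rank (p + 1))) :
    IsHomVec (A.deg p) (A.deg (p + 1) a) (A.d p (Pi.single a 1)) :=
  A.d_homogeneous p a

theorem d_d (A : MinimalGradedFreeResolution J) (p : ℕ) (x) : A.d p (A.d (p + 1) x) = 0 :=
  (A.exact_succ p).apply_apply_eq_zero x

theorem aug_d (A : MinimalGradedFreeResolution J) (x) : A.aug (A.d 0 x) = 0 :=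
  A.exact_zero.apply_apply_eq_zero x

theorem constantCoeff_d (A : MinimalGradedFreeResolution J) (p : ℕ) (x b) :
    constantCoeff (A.d p x b) = 0 := by
  rw [linearMap_apply_eq_sum (A.d p) x]
  simp [A.minimal]

theorem exists_isHomVec_aug_eq (B : MinimalGradedFreeResolution J)
    (hJ : J.IsHomogeneous (homogeneousSubmodule σ k)) {g : MvPolynomial σ k} {D : ℕ}
    (hg : g.IsHomogeneous D) :
    ∃ y, IsHomVec (B.deg 0) D y ∧ B.aug y = Ideal.Quotient.mk J g := by
  obtain ⟨y, hy⟩ := B.aug_surjective (Ideal.Quotient.mk J g)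
  choose γ hγ hγ' using B.aug_homogeneous
  -- The augmentation is lifted to a graded map into `R` itself, where homogeneous components are
  -- available.
  let Γ : (Fin (B.rank 0) → MvPolynomial σ k) →ₗ[MvPolynomial σ k] (Unit → MvPolynomial σ k) :=
    LinearMap.pi fun _ => ∑ b, (LinearMap.proj b).smulRight (γ b)
  have hΓ : ∀ x, B.aug x = Ideal.Quotient.mk J (Γ x ()) := by
    intro x
    rw [linearMap_apply_eq_sum B.aug x]
    simp only [hγ', Γ, LinearMap.pi_apply, LinearMap.sum_apply, LinearMap.smulRight_apply,
      LinearMap.proj_apply, smul_eq_mul, map_sum, map_mul]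
    refine Finset.sum_congr rfl fun a _ => ?_
    rfl
  have hΓhom : ∀ a, IsHomVec (fun _ : Unit => 0) (B.deg 0 a) (Γ (Pi.single a 1)) := by
    intro a b
    refine Or.inr ⟨B.deg 0 a, by simp, ?_⟩
    have : Γ (Pi.single a 1) b = γ a := by
      simp [Γ, Pi.single_apply]
    rw [this]; exact hγ a
  refine ⟨homComp (B.deg 0) D y, isHomVec_homComp y, ?_⟩
  rw [hΓ, map_homComp Γ hΓhom]
  rw [hΓ, Ideal.Quotient.eq] at hy
  rw [Ideal.Quotient.eq]
  have h := homogeneousComponent_mem_of_mem hJ hy D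
  rw [map_sub, homogeneousComponent_eq_self hg] at h
  simpa [homComp] using h

/-- Multiplication by a homogeneous element `f` of degree `c` with `f K ⊆ J` lifts to a graded
chain map between resolutions of `R/K` and `R/J`. -/
theorem exists_lift (A : MinimalGradedFreeResolution K) (B : MinimalGradedFreeResolution J)
    (hJ : J.IsHomogeneous (homogeneousSubmodule σ k)) {f : MvPolynomial σ k} {c : ℕ}
    (hf : f.IsHomogeneous c) (hfK : ∀ x ∈ K, f * x ∈ J) :
    ∃ φ : (p : ℕ) → (Fin (A.rank p) → MvPolynomial σ k) →ₗ[MvPolynomial σ k]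
        (Fin (B.rank p) → MvPolynomial σ k),
      (∀ p a, IsHomVec (B.deg p) (A.deg p a + c) (φ p (Pi.single a 1))) ∧
      (∀ x g, A.aug x = Ideal.Quotient.mk K g →
        B.aug (φ 0 x) = Ideal.Quotient.mk J (f * g)) ∧
      ∀ p x, φ p (A.d p x) = B.d p (φ (p + 1) x) := by
  obtain ⟨φ₀, h₀, h₀'⟩ : ∃ φ : (Fin (A.rank 0) → MvPolynomial σ k) →ₗ[MvPolynomial σ k]
      (Fin (B.rank 0) → MvPolynomial σ k),
      (∀ a, IsHomVec (B.deg 0) (A.deg 0 a + c) (φ (Pi.single a 1))) ∧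
      (∀ x g, A.aug x = Ideal.Quotient.mk K g →
        B.aug (φ x) = Ideal.Quotient.mk J (f * g)) := by
    choose γ hγ hγ' using A.aug_homogeneous
    have : ∀ a, ∃ y, IsHomVec (B.deg 0) (A.deg 0 a + c) y ∧
        B.aug y = Ideal.Quotient.mk J (f * γ a) := fun a =>
      B.exists_isHomVec_aug_eq hJ (by rw [add_comm]; exact hf.mul (hγ a))
    choose y hy hy' using this
    refine ⟨(Pi.basisFun (MvPolynomial σ k) (Fin (A.rank 0))).constr ℕ y, fun a => ?_, ?_⟩
    · rw [← Pi.basisFun_apply, Module.Basis.constr_basis]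
      exact hy a
    · intro x g hx
      have h1 : A.aug x = Ideal.Quotient.mk K (∑ a, x a * γ a) := by
        rw [linearMap_apply_eq_sum A.aug x]
        simp only [hγ', map_sum, map_mul]
        refine Finset.sum_congr rfl fun a _ => ?_
        rfl
      have h2 : B.aug ((Pi.basisFun (MvPolynomial σ k) (Fin (A.rank 0))).constr ℕ y x) =
          Ideal.Quotient.mk J (f * ∑ a, x a * γ a) := by
        rw [Module.Basis.constr_apply_fintype]
        simp only [map_sum, map_smul, hy', Pi.basisFun_equivFun, LinearEquiv.refl_apply,
          Finset.mul_sum]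
        refine Finset.sum_congr rfl fun a _ => ?_
        rw [mul_left_comm]; rfl
      rw [h2, Ideal.Quotient.eq, ← mul_sub]
      rw [hx, Ideal.Quotient.eq] at h1
      rw [← neg_sub, mul_neg]
      exact J.neg_mem (hfK _ h1)
  -- The recursion carries the condition that `φ ∘ A.d p` lands in the image of `B.d p`, which is
  -- what the construction of the next map requires.
  let S : ℕ → Type _ := fun p =>
    {φ : (Fin (A.rank p) → MvPolynomial σ k) →ₗ[MvPolynomial σ k]
      (Fin (B.rank p) → MvPolynomial σ k) //
      (∀ a, IsHomVec (B.deg p) (A.deg p a + c) (φ (Pi.single a 1))) ∧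
      ∀ x, φ (A.d p x) ∈ LinearMap.range (B.d p)}
  have step : ∀ p (φ : S p), ∃ ψ : S (p + 1), ∀ x, φ.1 (A.d p x) = B.d p (ψ.1 x) := by
    rintro p ⟨φ, hφ, hφ'⟩
    have : ∀ a, ∃ y, IsHomVec (B.deg (p + 1)) (A.deg (p + 1) a + c) y ∧
        B.d p y = φ (A.d p (Pi.single a 1)) := fun a =>
      IsHomVec.exists_preimage (B.d_isHomVec p) ((A.d_isHomVec p a).map hφ) (hφ' _)
    choose y hy hy' using this
    let ψ := (Pi.basisFun (MvPolynomial σ k) (Fin (A.rank (p + 1)))).constr ℕ y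
    have hψ : ∀ x, φ (A.d p x) = B.d p (ψ x) := by
      intro x
      have : φ ∘ₗ A.d p = B.d p ∘ₗ ψ := by
        refine (Pi.basisFun (MvPolynomial σ k) (Fin (A.rank (p + 1)))).ext fun a => ?_
        rw [LinearMap.comp_apply, LinearMap.comp_apply, Module.Basis.constr_basis, hy',
          Pi.basisFun_apply]
      exact LinearMap.congr_fun this x
    refine ⟨⟨ψ, fun a => ?_, fun x => ?_⟩, hψ⟩
    · rw [← Pi.basisFun_apply, Module.Basis.constr_basis]
      exact hy a
    · refine (B.exact_succ p _).1 ?_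
      rw [← hψ, A.d_d, map_zero]
  choose next hnext using step
  let s₀ : S 0 := ⟨φ₀, h₀, fun x => (B.exact_zero _).1 <| by
    rw [h₀' (A.d 0 x) 0 (by rw [A.aug_d, map_zero]), mul_zero, map_zero]⟩
  let φ : (p : ℕ) → S p := fun p => Nat.rec s₀ next p
  exact ⟨fun p => (φ p).1, fun p => (φ p).2.1, h₀', fun p x => hnext p (φ p) x⟩

theorem constantCoeff_map_eq_zero {ι κ : Type*} [Fintype ι] [DecidableEq ι]
    (g : (ι → MvPolynomial σ k) →ₗ[MvPolynomial σ k] (κ → MvPolynomial σ k))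
    {x : ι → MvPolynomial σ k} (hx : ∀ a, constantCoeff (x a) = 0) (b : κ) :
    constantCoeff (g x b) = 0 := by
  rw [linearMap_apply_eq_sum g x]
  simp [hx]

/-- A chain endomorphism lifting zero is null-homotopic, hence has entries in the irrelevant
ideal. -/
theorem constantCoeff_eq_zero_of_aug_eq_zero (A : MinimalGradedFreeResolution J)
    (e : (p : ℕ) → (Fin (A.rank p) → MvPolynomial σ k) →ₗ[MvPolynomial σ k]
        (Fin (A.rank p) → MvPolynomial σ k))
    (h₀ : ∀ x, A.aug (e 0 x) = 0) (h : ∀ p x, e p (A.d p x) = A.d p (e (p + 1) x))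
    (p : ℕ) (x b) : constantCoeff (e p x b) = 0 := by
  have lift : ∀ q (g : (Fin (A.rank q) → MvPolynomial σ k) →ₗ[MvPolynomial σ k]
        (Fin (A.rank q) → MvPolynomial σ k)), (∀ x, g x ∈ LinearMap.range (A.d q)) →
      ∃ l : (Fin (A.rank q) → MvPolynomial σ k) →ₗ[MvPolynomial σ k]
        (Fin (A.rank (q + 1)) → MvPolynomial σ k), ∀ x, g x = A.d q (l x) := by
    intro q g hg
    choose y hy using fun a => hg (Pi.single a 1)
    refine ⟨(Pi.basisFun (MvPolynomial σ k) (Fin (A.rank q))).constr ℕ y, fun x => ?_⟩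
    have : g = A.d q ∘ₗ (Pi.basisFun (MvPolynomial σ k) (Fin (A.rank q))).constr ℕ y := by
      refine (Pi.basisFun (MvPolynomial σ k) (Fin (A.rank q))).ext fun a => ?_
      rw [LinearMap.comp_apply, Module.Basis.constr_basis, hy, Pi.basisFun_apply]
    exact LinearMap.congr_fun this x
  -- The null-homotopy, one degree at a time: the map `l` found at one stage serves as `g` at the
  -- next.
  have main : ∀ q, ∃ (l : (Fin (A.rank (q + 1)) → MvPolynomial σ k) →ₗ[MvPolynomial σ k]
        (Fin (A.rank (q + 2)) → MvPolynomial σ k))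
      (g : (Fin (A.rank q) → MvPolynomial σ k) →ₗ[MvPolynomial σ k]
        (Fin (A.rank (q + 1)) → MvPolynomial σ k)),
      ∀ x, e (q + 1) x = A.d (q + 1) (l x) + g (A.d q x) := by
    intro q
    induction q with
    | zero =>
      obtain ⟨g, hg⟩ := lift 0 (e 0) fun x => (A.exact_zero _).1 (h₀ x)
      obtain ⟨l, hl⟩ := lift 1 (e 1 - g ∘ₗ A.d 0) fun x => (A.exact_succ 0 _).1 <| by
        simp only [LinearMap.sub_apply, LinearMap.comp_apply, map_sub, ← h, ← hg, sub_self]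
      exact ⟨l, g, fun x => by rw [← hl]; simp⟩
    | succ q ih =>
      obtain ⟨g, g', hg⟩ := ih
      obtain ⟨l, hl⟩ := lift (q + 2) (e (q + 2) - g ∘ₗ A.d (q + 1)) fun x =>
        (A.exact_succ (q + 1) _).1 <| by
          simp only [LinearMap.sub_apply, LinearMap.comp_apply, map_sub, ← h, hg, A.d_d, map_zero,
            add_zero, sub_self]
      exact ⟨l, g, fun x => by rw [← hl]; simp⟩
  cases p with
  | zero =>
    obtain ⟨y, hy⟩ := (A.exact_zero _).1 (h₀ x)
    rw [← hy]
    exact A.constantCoeff_d 0 y b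
  | succ q =>
    obtain ⟨l, g, hg⟩ := main q
    rw [hg, Pi.add_apply, map_add, A.constantCoeff_d, zero_add]
    exact constantCoeff_map_eq_zero g (A.constantCoeff_d q x) b

theorem constantCoeff_eq_zero_of_isHomVec {ι : Type*} {deg : ι → ℕ} {D : ℕ}
    {x : ι → MvPolynomial σ k} (hx : IsHomVec deg D x) {b : ι} (hb : deg b ≠ D) :
    constantCoeff (x b) = 0 := by
  rcases hx b with h | ⟨e, he, h⟩
  · rw [h, map_zero]
  · rw [constantCoeff_eq]
    by_contra hne
    have := h hne
    simp only [map_zero] at this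
    omega

/-- Lift the identity in both directions. The composite `ψ φ` is homotopic to the identity, hence by
minimality equal to it modulo the irrelevant ideal. On basis vectors of degree `j` the constant
terms of `φ` then form an injective map over `k`. -/
theorem betti_le (A B : MinimalGradedFreeResolution J)
    (hJ : J.IsHomogeneous (homogeneousSubmodule σ k)) (p j : ℕ) : A.betti p j ≤ B.betti p j := by
  obtain ⟨φ, hφ, hφ₀, hφd⟩ := exists_lift A B hJ (isHomogeneous_one σ k) (fun x hx => by simpa)
  obtain ⟨ψ, hψ, hψ₀, hψd⟩ := exists_lift B A hJ (isHomogeneous_one σ k) (fun x hx => by simpa)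
  have key := constantCoeff_eq_zero_of_aug_eq_zero A (fun p => ψ p ∘ₗ φ p - LinearMap.id)
    (fun x => by
      obtain ⟨g, hg⟩ := Ideal.Quotient.mk_surjective (A.aug x)
      have h1 := hφ₀ x g hg.symm
      have h2 := hψ₀ _ _ h1
      simp [h2, ← hg])
    (fun p x => by simp [hφd, hψd])
  set X := {a : Fin (A.rank p) // A.deg p a = j}
  set Y := {b : Fin (B.rank p) // B.deg p b = j}
  let P : (X → k) →ₗ[k] (Y → k) :=
    Matrix.toLin' (Matrix.of fun b a => constantCoeff (φ p (Pi.single a.1 1) b.1))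
  let Q : (Y → k) →ₗ[k] (X → k) :=
    Matrix.toLin' (Matrix.of fun a b => constantCoeff (ψ p (Pi.single b.1 1) a.1))
  have hQP : Q ∘ₗ P = LinearMap.id := by
    rw [← Matrix.toLin'_mul, ← Matrix.toLin'_one]
    congr 1
    ext a a'
    have h := key p (Pi.single a'.1 1) a.1
    simp only [LinearMap.sub_apply, LinearMap.comp_apply, LinearMap.id_apply, Pi.sub_apply,
      map_sub, sub_eq_zero] at h
    rw [linearMap_apply_eq_sum (ψ p)] at h
    simp only [Finset.sum_apply, Pi.smul_apply, smul_eq_mul, map_sum, map_mul] at h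
    rw [Matrix.mul_apply]
    simp only [Matrix.of_apply]
    -- Since `φ` preserves degrees, its entries between basis vectors of different degrees have no
    -- constant term.
    have h3 : ∑ b : Fin (B.rank p), constantCoeff (φ p (Pi.single a'.1 1) b) *
        constantCoeff (ψ p (Pi.single b 1) a.1) =
        ∑ b : Y, constantCoeff (φ p (Pi.single a'.1 1) b.1) *
        constantCoeff (ψ p (Pi.single b.1 1) a.1) := by
      rw [← Finset.sum_subtype (Finset.univ.filter fun b => B.deg p b = j) (by simp)
        (fun b => constantCoeff (φ p (Pi.single a'.1 1) b) *
          constantCoeff (ψ p (Pi.single b 1) a.1)), Finset.sum_filter_of_ne]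
      intro b _ hb
      by_contra hne
      apply hb
      rw [constantCoeff_eq_zero_of_isHomVec (hφ p a'.1) (b := b)
        (by rw [add_zero, a'.2]; exact hne), zero_mul]
    rw [h3] at h
    rw [Matrix.one_apply]
    refine (Finset.sum_congr rfl fun b _ => mul_comm _ _).trans (h.trans ?_)
    rw [Pi.single_apply]
    by_cases haa : a = a'
    · rw [if_pos haa, if_pos (congrArg Subtype.val haa), map_one]
    · rw [if_neg haa, if_neg fun h => haa (Subtype.ext h), map_zero]
  have hinj : Function.Injective P := by
    intro x y hxy
    have := congrArg Q hxy
    rwa [← LinearMap.comp_apply, ← LinearMap.comp_apply, hQP] at this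
  have := LinearMap.finrank_le_finrank_of_injective hinj
  rw [Module.finrank_fintype_fun_eq_card, Module.finrank_fintype_fun_eq_card,
    Fintype.card_subtype, Fintype.card_subtype] at this
  exact this

theorem betti_eq (A B : MinimalGradedFreeResolution J)
    (hJ : J.IsHomogeneous (homogeneousSubmodule σ k)) (p j : ℕ) : A.betti p j = B.betti p j :=
  (betti_le A B hJ p j).antisymm (betti_le B A hJ p j)

end Lift

end MinimalGradedFreeResolution

end StarConfiguration

namespace StarConfiguration

open MvPolynomial

attribute [local instance] MvPolynomial.gradedAlgebra

namespace MinimalGradedFreeResolution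

variable {σ k : Type*} [Field k] {J K : Ideal (MvPolynomial σ k)}

theorem betti_eq_sum (A : MinimalGradedFreeResolution J) (p j : ℕ) :
    A.betti p j = ∑ a, if A.deg p a = j then 1 else 0 := by
  rw [betti, Finset.card_filter]

theorem betti_pos (A : MinimalGradedFreeResolution J) (p : ℕ) (a) : 0 < A.betti p (A.deg p a) :=
  Finset.card_pos.2 ⟨a, by simp⟩

/-! ### Mapping cones. -/

section Cone

/-- Vectors over `Fin (m + n)` as pairs of vectors. -/
noncomputable def appendEquiv (R : Type*) [CommRing R] (m n : ℕ) :
    (Fin (m + n) → R) ≃ₗ[R] (Fin m → R) × (Fin n → R) :=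
  (LinearEquiv.funCongrLeft R R finSumFinEquiv).trans
    (LinearEquiv.sumArrowLequivProdArrow _ _ R R)

theorem appendEquiv_apply {R : Type*} [CommRing R] {m n : ℕ} (x : Fin (m + n) → R) :
    appendEquiv R m n x = (fun i => x (Fin.castAdd n i), fun i => x (Fin.natAdd m i)) := by
  ext <;> simp [appendEquiv, LinearEquiv.funCongrLeft, LinearMap.funLeft]

theorem appendEquiv_symm_castAdd {R : Type*} [CommRing R] {m n : ℕ}
    (x : (Fin m → R) × (Fin n → R)) (i) :
    (appendEquiv R m n).symm x (Fin.castAdd n i) = x.1 i := by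
  obtain ⟨y, rfl⟩ := (appendEquiv R m n).surjective x
  rw [LinearEquiv.symm_apply_apply, appendEquiv_apply]

theorem appendEquiv_symm_natAdd {R : Type*} [CommRing R] {m n : ℕ}
    (x : (Fin m → R) × (Fin n → R)) (i) :
    (appendEquiv R m n).symm x (Fin.natAdd m i) = x.2 i := by
  obtain ⟨y, rfl⟩ := (appendEquiv R m n).surjective x
  rw [LinearEquiv.symm_apply_apply, appendEquiv_apply]

theorem appendEquiv_single_castAdd {R : Type*} [CommRing R] {m n : ℕ} (i : Fin m) :
    appendEquiv R m n (Pi.single (Fin.castAdd n i) 1) = (Pi.single i 1, 0) := by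
  rw [appendEquiv_apply]
  ext j
  · simp [Pi.single_apply]
  · simp [Pi.single_apply, Fin.ext_iff]; omega

theorem appendEquiv_single_natAdd {R : Type*} [CommRing R] {m n : ℕ} (i : Fin n) :
    appendEquiv R m n (Pi.single (Fin.natAdd m i) 1) = (0, Pi.single i 1) := by
  rw [appendEquiv_apply]
  ext j
  · simp [Pi.single_apply, Fin.ext_iff]; omega
  · simp [Pi.single_apply]

variable (A : MinimalGradedFreeResolution K) (B : MinimalGradedFreeResolution J)
  (φ : (p : ℕ) → (Fin (A.rank p) → MvPolynomial σ k) →ₗ[MvPolynomial σ k]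
        (Fin (B.rank p) → MvPolynomial σ k))

/-- The differential of the mapping cone of `φ` in homological degree one. -/
noncomputable def coneDZero :
    (Fin (B.rank (0 + 1) + A.rank 0) → MvPolynomial σ k) →ₗ[MvPolynomial σ k]
      (Fin (B.rank 0) → MvPolynomial σ k) :=
  (B.d 0).coprod (φ 0) ∘ₗ (appendEquiv _ (B.rank (0 + 1)) (A.rank 0)).toLinearMap

/-- The differentials of the mapping cone of `φ` in homological degrees at least two. -/
noncomputable def coneDSucc (p : ℕ) :
    (Fin (B.rank (p + 1 + 1) + A.rank (p + 1)) → MvPolynomial σ k) →ₗ[MvPolynomial σ k]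
      (Fin (B.rank (p + 1) + A.rank p) → MvPolynomial σ k) :=
  (appendEquiv _ (B.rank (p + 1)) (A.rank p)).symm.toLinearMap ∘ₗ
    (((B.d (p + 1)).coprod (φ (p + 1))).prod (-(A.d p) ∘ₗ LinearMap.snd _ _ _)) ∘ₗ
      (appendEquiv _ (B.rank (p + 1 + 1)) (A.rank (p + 1))).toLinearMap

theorem coneDSucc_apply (p : ℕ) (x) :
    coneDSucc A B φ p x = (appendEquiv _ (B.rank (p + 1)) (A.rank p)).symm
      (B.d (p + 1) (appendEquiv _ (B.rank (p + 1 + 1)) (A.rank (p + 1)) x).1 +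
        φ (p + 1) (appendEquiv _ (B.rank (p + 1 + 1)) (A.rank (p + 1)) x).2,
      -A.d p (appendEquiv _ (B.rank (p + 1 + 1)) (A.rank (p + 1)) x).2) := rfl

theorem coneDZero_apply (x) :
    coneDZero A B φ x = B.d 0 (appendEquiv _ (B.rank (0 + 1)) (A.rank 0) x).1 +
        φ 0 (appendEquiv _ (B.rank (0 + 1)) (A.rank 0) x).2 := rfl

variable {A B φ} {f : MvPolynomial σ k} {c : ℕ}

theorem coneDZero_isHomVec
    (hφ : ∀ p a, IsHomVec (B.deg p) (A.deg p a + c) (φ p (Pi.single a 1))) (a) :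
    IsHomVec (B.deg 0) (Fin.append (B.deg (0 + 1)) (fun a => A.deg 0 a + c) a)
      (coneDZero A B φ (Pi.single a 1)) := by
  refine Fin.addCases (fun i => ?_) (fun i => ?_) a
  · rw [coneDZero_apply, appendEquiv_single_castAdd]
    simpa using B.d_isHomVec 0 i
  · rw [coneDZero_apply, appendEquiv_single_natAdd]
    simpa using hφ 0 i

theorem coneDSucc_isHomVec
    (hφ : ∀ p a, IsHomVec (B.deg p) (A.deg p a + c) (φ p (Pi.single a 1))) (p : ℕ) (a) :
    IsHomVec (Fin.append (B.deg (p + 1)) (fun a => A.deg p a + c))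
      (Fin.append (B.deg (p + 1 + 1)) (fun a => A.deg (p + 1) a + c) a)
      (coneDSucc A B φ p (Pi.single a 1)) := by
  intro b
  refine Fin.addCases (fun i => ?_) (fun i => ?_) a <;>
    refine Fin.addCases (fun j => ?_) (fun j => ?_) b
  · rw [coneDSucc_apply, appendEquiv_single_castAdd, appendEquiv_symm_castAdd]
    simpa using B.d_isHomVec (p + 1) i j
  · rw [coneDSucc_apply, appendEquiv_single_castAdd, appendEquiv_symm_natAdd]
    simp
  · rw [coneDSucc_apply, appendEquiv_single_natAdd, appendEquiv_symm_castAdd]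
    simpa using hφ (p + 1) i j
  · rw [coneDSucc_apply, appendEquiv_single_natAdd, appendEquiv_symm_natAdd]
    rcases A.d_isHomVec p i j with h | ⟨e, he, h⟩
    · left; simp [h]
    · right
      refine ⟨e, by simp only [Fin.append_right]; omega, ?_⟩
      simpa using h.neg

theorem coneDZero_minimal (hφ : ∀ p a b, constantCoeff (φ p (Pi.single a 1) b) = 0) (a b) :
    constantCoeff (coneDZero A B φ (Pi.single a 1) b) = 0 := by
  refine Fin.addCases (fun i => ?_) (fun i => ?_) a
  · rw [coneDZero_apply, appendEquiv_single_castAdd]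
    simpa using B.minimal 0 i b
  · rw [coneDZero_apply, appendEquiv_single_natAdd]
    simpa using hφ 0 i b

theorem coneDSucc_minimal (hφ : ∀ p a b, constantCoeff (φ p (Pi.single a 1) b) = 0)
    (p : ℕ) (a b) : constantCoeff (coneDSucc A B φ p (Pi.single a 1) b) = 0 := by
  refine Fin.addCases (fun i => ?_) (fun i => ?_) a <;>
    refine Fin.addCases (fun j => ?_) (fun j => ?_) b
  · rw [coneDSucc_apply, appendEquiv_single_castAdd, appendEquiv_symm_castAdd]
    simpa using B.minimal (p + 1) i j
  · rw [coneDSucc_apply, appendEquiv_single_castAdd, appendEquiv_symm_natAdd]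
    simp
  · rw [coneDSucc_apply, appendEquiv_single_natAdd, appendEquiv_symm_castAdd]
    simpa using hφ (p + 1) i j
  · rw [coneDSucc_apply, appendEquiv_single_natAdd, appendEquiv_symm_natAdd]
    simpa using A.minimal p i j

/-- This is where `K = J : f` enters: if `φ 0 a` is a boundary and `g` represents `A.aug a`, then `f
* g ∈ J`, so `g ∈ K` and `a` is a boundary as well. -/
theorem coneD_exact_one (hK : ∀ x, x ∈ K ↔ f * x ∈ J)
    (hφ₀ : ∀ x g, A.aug x = Ideal.Quotient.mk K g →
      B.aug (φ 0 x) = Ideal.Quotient.mk J (f * g))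
    (hφd : ∀ p x, φ p (A.d p x) = B.d p (φ (p + 1) x)) :
    Function.Exact (coneDSucc A B φ 0) (coneDZero A B φ) := by
  intro x
  rw [coneDZero_apply]
  constructor
  · intro h
    obtain ⟨⟨b, a⟩, rfl⟩ := (appendEquiv _ (B.rank (0 + 1)) (A.rank 0)).symm.surjective x
    rw [LinearEquiv.apply_symm_apply] at h
    dsimp only at h
    have ha : A.aug a = 0 := by
      obtain ⟨g, hg⟩ := Ideal.Quotient.mk_surjective (A.aug a)
      have h1 := hφ₀ a g hg.symm
      have h2 := congrArg B.aug h
      rw [map_add, B.aug_d, zero_add, h1, map_zero, Ideal.Quotient.eq_zero_iff_mem, ← hK] at h2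
      rw [← hg, Ideal.Quotient.eq_zero_iff_mem]
      exact h2
    obtain ⟨a', rfl⟩ := (A.exact_zero a).1 ha
    rw [hφd, ← map_add] at h
    obtain ⟨b', hb'⟩ := (B.exact_succ 0 _).1 h
    refine ⟨(appendEquiv _ (B.rank (0 + 1 + 1)) (A.rank (0 + 1))).symm (b', -a'), ?_⟩
    rw [coneDSucc_apply, LinearEquiv.apply_symm_apply]
    simp [hb']
  · rintro ⟨y, rfl⟩
    rw [coneDSucc_apply, LinearEquiv.apply_symm_apply]
    simp [hφd, B.d_d]

theorem coneD_exact_succ (hφd : ∀ p x, φ p (A.d p x) = B.d p (φ (p + 1) x)) (p : ℕ) :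
    Function.Exact (coneDSucc A B φ (p + 1)) (coneDSucc A B φ p) := by
  intro x
  rw [coneDSucc_apply]
  constructor
  · intro h
    obtain ⟨⟨b, a⟩, rfl⟩ :=
      (appendEquiv _ (B.rank (p + 1 + 1)) (A.rank (p + 1))).symm.surjective x
    rw [LinearEquiv.apply_symm_apply, LinearEquiv.map_eq_zero_iff, Prod.mk_eq_zero] at h
    obtain ⟨h, ha⟩ := h
    rw [neg_eq_zero] at ha
    obtain ⟨a', rfl⟩ := (A.exact_succ p a).1 ha
    dsimp only at h
    rw [hφd, ← map_add] at h
    obtain ⟨b', hb'⟩ := (B.exact_succ (p + 1) _).1 h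
    refine ⟨(appendEquiv _ (B.rank (p + 1 + 1 + 1)) (A.rank (p + 1 + 1))).symm (b', -a'), ?_⟩
    rw [coneDSucc_apply, LinearEquiv.apply_symm_apply]
    simp [hb']
  · rintro ⟨y, rfl⟩
    rw [coneDSucc_apply, LinearEquiv.apply_symm_apply, LinearEquiv.map_eq_zero_iff]
    simp [hφd, B.d_d, A.d_d]

theorem coneD_exact_zero
    (hφ₀ : ∀ x g, A.aug x = Ideal.Quotient.mk K g →
      B.aug (φ 0 x) = Ideal.Quotient.mk J (f * g))
    (π : (MvPolynomial σ k ⧸ J) →ₗ[MvPolynomial σ k]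
      (MvPolynomial σ k ⧸ (J ⊔ Ideal.span {f})))
    (hπ : ∀ g, π (Ideal.Quotient.mk J g) = Ideal.Quotient.mk _ g) :
    Function.Exact (coneDZero A B φ) (π ∘ₗ B.aug) := by
  intro x
  rw [LinearMap.comp_apply]
  constructor
  · intro h
    obtain ⟨g, hg⟩ := Ideal.Quotient.mk_surjective (B.aug x)
    rw [← hg, hπ, Ideal.Quotient.eq_zero_iff_mem, Submodule.mem_sup] at h
    obtain ⟨u, hu, v, hv, rfl⟩ := h
    obtain ⟨w, rfl⟩ := Ideal.mem_span_singleton.1 hv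
    obtain ⟨a, ha⟩ := A.aug_surjective (Ideal.Quotient.mk K w)
    have h1 : B.aug (x - φ 0 a) = 0 := by
      rw [map_sub, hφ₀ a w ha, ← hg, ← map_sub, Ideal.Quotient.eq_zero_iff_mem]
      simpa using hu
    obtain ⟨b, hb⟩ := (B.exact_zero _).1 h1
    refine ⟨(appendEquiv _ (B.rank (0 + 1)) (A.rank 0)).symm (b, a), ?_⟩
    rw [coneDZero_apply, LinearEquiv.apply_symm_apply]
    simp [hb]
  · rintro ⟨y, rfl⟩
    rw [coneDZero_apply, map_add, B.aug_d, zero_add]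
    obtain ⟨g, hg⟩ := Ideal.Quotient.mk_surjective
      (A.aug (appendEquiv _ (B.rank (0 + 1)) (A.rank 0) y).2)
    rw [hφ₀ _ g hg.symm, hπ, Ideal.Quotient.eq_zero_iff_mem]
    exact Ideal.mem_sup_right (Ideal.mul_mem_right _ _ (Ideal.mem_span_singleton_self f))

/-- The ranks of the modules in a mapping cone. -/
def coneRank (A : MinimalGradedFreeResolution K) (B : MinimalGradedFreeResolution J) : ℕ → ℕ
  | 0 => B.rank 0
  | p + 1 => B.rank (p + 1) + A.rank p

/-- The degrees of the basis vectors in the mapping cone of a chain map of degree `c`. -/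
def coneDeg (A : MinimalGradedFreeResolution K) (B : MinimalGradedFreeResolution J) (c : ℕ) :
    (p : ℕ) → Fin (coneRank A B p) → ℕ
  | 0 => B.deg 0
  | p + 1 => Fin.append (B.deg (p + 1)) fun a => A.deg p a + c

/-- The differentials of the mapping cone of `φ`. -/
noncomputable def coneD (A : MinimalGradedFreeResolution K) (B : MinimalGradedFreeResolution J)
    (φ : (p : ℕ) → (Fin (A.rank p) → MvPolynomial σ k) →ₗ[MvPolynomial σ k]
        (Fin (B.rank p) → MvPolynomial σ k)) : (p : ℕ) →
    (Fin (coneRank A B (p + 1)) → MvPolynomial σ k) →ₗ[MvPolynomial σ k]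
      (Fin (coneRank A B p) → MvPolynomial σ k)
  | 0 => coneDZero A B φ
  | p + 1 => coneDSucc A B φ p

/-- If `K = J : f` and the degrees in the resolution of `R/J` are smaller than those in the
shifted resolution of `R/K`, the mapping cone of a lift of multiplication by `f` is a minimal
resolution of `R/(J + (f))`. -/
theorem exists_cone (A : MinimalGradedFreeResolution K) (B : MinimalGradedFreeResolution J)
    (hJ : J.IsHomogeneous (homogeneousSubmodule σ k)) (hf : f.IsHomogeneous c)
    (hK : ∀ x, x ∈ K ↔ f * x ∈ J) (hdeg : ∀ p a b, B.deg p b < A.deg p a + c) :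
    ∃ C : MinimalGradedFreeResolution (J ⊔ Ideal.span {f}),
      (∀ j, C.betti 0 j = B.betti 0 j) ∧
      ∀ p j, C.betti (p + 1) j =
        B.betti (p + 1) j + if c ≤ j then A.betti p (j - c) else 0 := by
  obtain ⟨φ, hφ, hφ₀, hφd⟩ := exists_lift A B hJ hf fun x hx => (hK x).1 hx
  -- The strict inequality of degrees forbids constant entries in any graded lift, so the cone is
  -- minimal without further knowledge of `φ`.
  have hmin : ∀ p a b, constantCoeff (φ p (Pi.single a 1) b) = 0 := fun p a b =>
    constantCoeff_eq_zero_of_isHomVec (hφ p a) (hdeg p a b).ne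
  let π : (MvPolynomial σ k ⧸ J) →ₗ[MvPolynomial σ k]
      (MvPolynomial σ k ⧸ (J ⊔ Ideal.span {f})) := Submodule.factor le_sup_left
  have hπ : ∀ g, π (Ideal.Quotient.mk J g) = Ideal.Quotient.mk _ g := fun g => rfl
  have hπs : Function.Surjective π := fun y => by
    obtain ⟨g, rfl⟩ := Ideal.Quotient.mk_surjective y
    exact ⟨_, hπ g⟩
  refine ⟨⟨coneRank A B, coneDeg A B c, coneD A B φ, π ∘ₗ B.aug,
    fun p => match p with
      | 0 => coneDZero_isHomVec hφ
      | p + 1 => coneDSucc_isHomVec hφ p, fun a => ?_,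
    hπs.comp B.aug_surjective, coneD_exact_zero hφ₀ π hπ,
    fun p => match p with
      | 0 => coneD_exact_one hK hφ₀ hφd
      | p + 1 => coneD_exact_succ hφd p,
    fun p => match p with
      | 0 => coneDZero_minimal hmin
      | p + 1 => coneDSucc_minimal hmin p⟩,
    fun j => rfl, fun p j => ?_⟩
  · obtain ⟨g, hg, hg'⟩ := B.aug_homogeneous a
    exact ⟨g, hg, (congrArg π hg').trans (hπ g)⟩
  · rw [betti_eq_sum]
    refine (Fin.sum_univ_add _).trans ?_
    rw [betti_eq_sum]
    congr 1
    · simp [coneDeg]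
    · simp only [coneDeg, Fin.append_right]
      split_ifs with h
      · rw [betti_eq_sum]
        refine Finset.sum_congr rfl fun a _ => ?_
        congr 1
        exact propext ⟨fun h => by omega, fun h => by omega⟩
      · refine Finset.sum_eq_zero fun a _ => if_neg (by omega)

end Cone

/-- The resolution of `R` itself. -/
theorem exists_bot : ∃ C : MinimalGradedFreeResolution (⊥ : Ideal (MvPolynomial σ k)),
    ∀ p j, C.betti p j = if p = 0 ∧ j = 0 then 1 else 0 := by
  let rk : ℕ → ℕ := fun p => if p = 0 then 1 else 0
  have hsub : ∀ p, Subsingleton (Fin (rk (p + 1)) → MvPolynomial σ k) := fun p => by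
    have : IsEmpty (Fin (rk (p + 1))) := by simp only [rk]; exact Fin.isEmpty
    infer_instance
  let g : (Fin (rk 0) → MvPolynomial σ k) →ₗ[MvPolynomial σ k]
      (MvPolynomial σ k ⧸ (⊥ : Ideal (MvPolynomial σ k))) :=
    (Submodule.mkQ ⊥) ∘ₗ LinearMap.proj (0 : Fin 1)
  refine ⟨⟨rk, fun _ _ => 0, fun p => 0, g, fun _ _ _ => Or.inl rfl, fun a => ?_, ?_, ?_, ?_,
    fun _ _ _ => by simp⟩, ?_⟩
  · refine ⟨1, isHomogeneous_one σ k, ?_⟩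
    have : a = (0 : Fin 1) := Subsingleton.elim (α := Fin 1) _ _
    subst this
    simp [g]
  · intro y
    obtain ⟨x, rfl⟩ := Ideal.Quotient.mk_surjective y
    exact ⟨fun _ => x, rfl⟩
  · intro x
    constructor
    · intro h
      refine ⟨0, ?_⟩
      funext i
      have h' : (Ideal.Quotient.mk ⊥ (x (0 : Fin 1)) : MvPolynomial σ k ⧸ _) = 0 := h
      rw [Ideal.Quotient.eq_zero_iff_mem, Ideal.mem_bot] at h'
      have : i = (0 : Fin 1) := Subsingleton.elim (α := Fin 1) _ _
      rw [this, h']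
      rfl
    · rintro ⟨y, rfl⟩
      simp
  · intro p x
    have := hsub p
    exact ⟨fun _ => ⟨0, Subsingleton.elim _ _⟩, fun _ => by simp⟩
  · intro p j
    rw [betti_eq_sum]
    cases p with
    | zero =>
      have : ∑ a : Fin 1, (if 0 = j then 1 else 0 : ℕ) = if (0 : ℕ) = 0 ∧ j = 0 then 1 else 0 := by
        simp [eq_comm]
      exact this
    | succ p =>
      have : IsEmpty (Fin (rk (p + 1))) := by simp only [rk]; exact Fin.isEmpty
      simp

end MinimalGradedFreeResolution

end StarConfiguration

namespace StarConfiguration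

set_option linter.unusedSectionVars false

/-! ### Monomials in forms that are regular modulo few others. -/

section Regular

variable {R ι : Type*} [CommRing R] [DecidableEq ι]

/-- Every `F j` is a nonzerodivisor modulo the ideal generated by at most `c` other `F i`. -/
def RegularUpTo (F : ι → R) (c : ℕ) : Prop :=
  ∀ Z : Finset ι, Z.card ≤ c → ∀ j ∉ Z, ∀ x,
    F j * x ∈ Ideal.span (F '' (Z : Set ι)) → x ∈ Ideal.span (F '' (Z : Set ι))

/-- The ideal generated by the powers `F i ^ n i`, `i ∈ Z`. -/
def powIdeal (F : ι → R) (Z : Finset ι) (n : ι → ℕ) : Ideal R :=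
  Ideal.span ((fun i => F i ^ n i) '' (Z : Set ι))

variable {F : ι → R} {c : ℕ} {Z : Finset ι} {n : ι → ℕ}

theorem powIdeal_congr {n' : ι → ℕ} (h : ∀ i ∈ Z, n i = n' i) :
    powIdeal F Z n = powIdeal F Z n' := by
  unfold powIdeal
  congr 1
  exact Set.image_congr fun i hi => by rw [h i hi]

theorem powIdeal_one (h : ∀ i ∈ Z, n i = 1) :
    powIdeal F Z n = Ideal.span (F '' (Z : Set ι)) := by
  unfold powIdeal
  congr 1
  exact Set.image_congr fun i hi => by rw [h i hi, pow_one]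

theorem mem_powIdeal_update {i : ι} (hi : i ∈ Z) {v : ℕ} {x : R} :
    x ∈ powIdeal F Z (Function.update n i v) ↔
      ∃ w, ∃ y ∈ powIdeal F (Z.erase i) n, x = w * F i ^ v + y := by
  have h : powIdeal F Z (Function.update n i v) = Ideal.span (insert (F i ^ v)
      ((fun i => F i ^ n i) '' ((Z.erase i : Finset ι) : Set ι))) := by
    unfold powIdeal
    congr 1
    conv_lhs => rw [← Finset.insert_erase hi, Finset.coe_insert, Set.image_insert_eq]
    rw [Function.update_self]
    congr 1
    refine Set.image_congr fun j hj => ?_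
    rw [Function.update_of_ne (Finset.ne_of_mem_erase (Finset.mem_coe.1 hj))]
  rw [h, Ideal.mem_span_insert]
  rfl

theorem mem_powIdeal {i : ι} (hi : i ∈ Z) {x : R} :
    x ∈ powIdeal F Z n ↔ ∃ w, ∃ y ∈ powIdeal F (Z.erase i) n, x = w * F i ^ n i + y := by
  rw [← mem_powIdeal_update hi, Function.update_eq_self]

/-- Induction on the sum of the exponents, over all `Z` and `j`. If all exponents are one, this is
the hypothesis. If `n i = u + 1 ≥ 2`, lowering that exponent to one gives `x = z F_i + y'` by
induction. Cancelling `F_i` modulo the other powers puts `F_j z` in the ideal with exponent `u`; by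
induction `z` lies there, and multiplying by `F_i` restores the exponent. -/
theorem RegularUpTo.mem_powIdeal_of_mul_mem (hF : RegularUpTo F c) (hZ : Z.card ≤ c) {j : ι}
    (hj : j ∉ Z) {x : R} (hx : F j * x ∈ powIdeal F Z n) : x ∈ powIdeal F Z n := by
  induction hN : ∑ i ∈ Z, n i using Nat.strong_induction_on generalizing Z n j x with
  | _ N ih =>
  subst hN
  by_cases h0 : ∃ i ∈ Z, n i = 0
  · obtain ⟨i, hi, h⟩ := h0
    rw [mem_powIdeal hi]
    exact ⟨x, 0, Ideal.zero_mem _, by simp [h]⟩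
  by_cases h2 : ∃ i ∈ Z, 2 ≤ n i
  · obtain ⟨i, hi, h⟩ := h2
    have hne : j ≠ i := fun h => hj (h ▸ hi)
    have hsum : n i + ∑ l ∈ Z.erase i, n l = ∑ l ∈ Z, n l := Finset.add_sum_erase Z n hi
    have hcard : (Z.erase i).card ≤ c := (Finset.card_erase_le).trans hZ
    have hlow : ∀ v < n i, ∀ y, F j * y ∈ powIdeal F Z (Function.update n i v) →
        y ∈ powIdeal F Z (Function.update n i v) := by
      intro v hv y hy
      refine ih _ ?_ hZ hj hy rfl
      rw [← Finset.add_sum_erase Z _ hi, Function.update_self,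
        Finset.sum_congr rfl fun l hl =>
          Function.update_of_ne (Finset.ne_of_mem_erase hl) v n]
      change v + ∑ l ∈ Z.erase i, n l < _
      omega
    obtain ⟨u, hu⟩ : ∃ u, n i = u + 1 := ⟨n i - 1, by omega⟩
    obtain ⟨w, y, hy, hxy⟩ := (mem_powIdeal hi).1 hx
    have h1 : x ∈ powIdeal F Z (Function.update n i 1) := by
      refine hlow 1 (by omega) x ((mem_powIdeal_update hi).2 ⟨w * F i ^ u, y, hy, ?_⟩)
      rw [hxy, hu, pow_succ]; ring
    obtain ⟨z, y', hy', rfl⟩ := (mem_powIdeal_update hi).1 h1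
    have h3 : F i * (F j * z - w * F i ^ u) ∈ powIdeal F (Z.erase i) n := by
      have : F i * (F j * z - w * F i ^ u) = y - F j * y' := by
        rw [hu, pow_succ] at hxy
        linear_combination hxy
      rw [this]
      exact Ideal.sub_mem _ hy (Ideal.mul_mem_left _ _ hy')
    have h4 := ih _ (by omega) hcard (Finset.notMem_erase i Z) h3 rfl
    have h5 := hlow u (by omega) z ((mem_powIdeal_update hi).2 ⟨w, _, h4, by ring⟩)
    obtain ⟨w', y'', hy'', rfl⟩ := (mem_powIdeal_update hi).1 h5
    refine (mem_powIdeal hi).2 ⟨w', F i * y'' + y', Ideal.add_mem _ (Ideal.mul_mem_left _ _ hy'')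
      hy', ?_⟩
    rw [hu, pow_succ]; ring
  · have h1 : ∀ i ∈ Z, n i = 1 := by
      intro i hi
      have h3 : n i ≠ 0 := fun h => h0 ⟨i, hi, h⟩
      have h4 : ¬ 2 ≤ n i := fun h => h2 ⟨i, hi, h⟩
      omega
    rw [powIdeal_one h1] at hx ⊢
    exact hF Z hZ j hj x hx

theorem RegularUpTo.mem_powIdeal_of_pow_mul_mem (hF : RegularUpTo F c) (hZ : Z.card ≤ c) {j : ι}
    (hj : j ∉ Z) {x : R} {e : ℕ} (hx : F j ^ e * x ∈ powIdeal F Z n) : x ∈ powIdeal F Z n := by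
  induction e with
  | zero => simpa using hx
  | succ e ih =>
    rw [pow_succ', mul_assoc] at hx
    exact ih (hF.mem_powIdeal_of_mul_mem hZ hj hx)

theorem RegularUpTo.mem_powIdeal_of_mul_mem_succ (hF : RegularUpTo F c) (hZ : Z.card ≤ c) {i : ι}
    (hi : i ∈ Z) {x : R} (hx : F i * x ∈ powIdeal F Z (Function.update n i (n i + 1))) :
    x ∈ powIdeal F Z n := by
  obtain ⟨w, y, hy, hxy⟩ := (mem_powIdeal_update hi).1 hx
  have h : F i * (x - w * F i ^ n i) ∈ powIdeal F (Z.erase i) n := by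
    have : F i * (x - w * F i ^ n i) = y := by rw [pow_succ] at hxy; linear_combination hxy
    rwa [this]
  exact (mem_powIdeal hi).2 ⟨w, _, hF.mem_powIdeal_of_mul_mem
    ((Finset.card_erase_le).trans hZ) (Finset.notMem_erase i Z) h, by ring⟩

variable [Fintype ι]

/-- The monomial with exponents `a` in the elements `F i`. -/
def mon (F : ι → R) (a : ι → ℕ) : R := ∏ i, F i ^ a i

theorem mon_add (a b : ι → ℕ) : mon F (a + b) = mon F a * mon F b := by
  simp [mon, pow_add, Finset.prod_mul_distrib]

theorem mon_single (i : ι) (e : ℕ) : mon F (Pi.single i e) = F i ^ e := by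
  rw [mon, Finset.prod_eq_single i]
  · simp
  · intro j _ hj
    simp [Pi.single_eq_of_ne hj]
  · simp

theorem mon_zero : mon F 0 = 1 := by simp [mon]

theorem mon_dvd_mon {a b : ι → ℕ} (h : a ≤ b) : mon F a ∣ mon F b :=
  Finset.prod_dvd_prod_of_dvd _ _ fun i _ => pow_dvd_pow _ (h i)

/-- The ideal generated by the monomials with exponents in `E`. -/
def monIdeal (F : ι → R) (E : Set (ι → ℕ)) : Ideal R := Ideal.span (mon F '' E)

theorem mon_mem_monIdeal {E : Set (ι → ℕ)} {a b : ι → ℕ} (hb : b ∈ E) (h : b ≤ a) :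
    mon F a ∈ monIdeal F E :=
  Ideal.mem_of_dvd _ (mon_dvd_mon h) (Ideal.subset_span ⟨b, hb, rfl⟩)

theorem monIdeal_insert (a : ι → ℕ) (E : Set (ι → ℕ)) :
    monIdeal F (insert a E) = monIdeal F E ⊔ Ideal.span {mon F a} := by
  rw [monIdeal, Set.image_insert_eq, Ideal.span_insert, sup_comm]; rfl

/-- The factors of the monomial are cancelled one at a time: a factor `F i` with `i ∈ Z` lowers the
exponent at `i` by one, and any other factor is regular modulo the pure powers. -/
theorem RegularUpTo.mem_powIdeal_of_mon_mul_mem (hF : RegularUpTo F c) (hZ : Z.card ≤ c)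
    {a : ι → ℕ} {x : R} (hx : mon F a * x ∈ powIdeal F Z (n + a)) : x ∈ powIdeal F Z n := by
  induction hN : ∑ i, a i generalizing a with
  | zero =>
    have : a = 0 := by
      funext i
      exact (Finset.sum_eq_zero_iff.1 hN) i (Finset.mem_univ i)
    subst this
    simpa [mon_zero] using hx
  | succ N ih =>
    obtain ⟨i, -, hi⟩ : ∃ i ∈ Finset.univ, a i ≠ 0 := Finset.exists_ne_zero_of_sum_ne_zero
      (by omega)
    obtain ⟨b, rfl⟩ : ∃ b, a = b + Pi.single i 1 := by
      refine ⟨a - Pi.single i 1, (tsub_add_cancel_of_le ?_).symm⟩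
      intro j
      by_cases h : j = i
      · subst h; simp; omega
      · simp [Pi.single_eq_of_ne h]
    refine ih (a := b) ?_ ?_
    · rw [mon_add, mon_single, pow_one, mul_comm (mon F b), mul_assoc] at hx
      by_cases hiZ : i ∈ Z
      · refine hF.mem_powIdeal_of_mul_mem_succ hZ hiZ ?_
        convert hx using 2
        funext j
        by_cases h : j = i
        · subst h; simp; omega
        · simp [Function.update_of_ne h, Pi.single_eq_of_ne h]
      · refine hF.mem_powIdeal_of_mul_mem hZ hiZ ?_
        convert hx using 1
        refine powIdeal_congr fun j hj => ?_
        have : j ≠ i := fun h => hiZ (h ▸ hj)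
        simp [Pi.single_eq_of_ne this]
    · have : ∑ j, (b + Pi.single i 1 : ι → ℕ) j = ∑ j, b j + 1 := by
        simp [Finset.sum_add_distrib]
      omega

/-- The colon ideal of a monomial ideal by a monomial `a`, all of whose generators exceed `a` in
some coordinate of `Z`. -/
theorem RegularUpTo.mem_span_of_mon_mul_mem (hF : RegularUpTo F c) (hZ : Z.card ≤ c)
    {E : Set (ι → ℕ)} {a : ι → ℕ} (hE : ∀ b ∈ E, ∃ i ∈ Z, a i < b i) {x : R}
    (hx : mon F a * x ∈ monIdeal F E) : x ∈ Ideal.span (F '' (Z : Set ι)) := by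
  rw [← powIdeal_one (n := 1) fun i _ => rfl]
  refine hF.mem_powIdeal_of_mon_mul_mem hZ (a := a) ?_
  -- Keeping only a coordinate of `Z` where `b` exceeds `a` enlarges the monomial ideal to one
  -- generated by pure powers, whose colon by `a` is known.
  suffices h : monIdeal F E ≤ powIdeal F Z (1 + a) from h hx
  rw [monIdeal, Ideal.span_le]
  rintro _ ⟨b, hb, rfl⟩
  obtain ⟨i, hi, hlt⟩ := hE b hb
  have h1 : F i ^ (1 + a) i ∣ mon F b :=
    (pow_dvd_pow _ (by simp only [Pi.add_apply, Pi.one_apply]; omega)).trans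
      (Finset.dvd_prod_of_mem (fun i => F i ^ b i) (Finset.mem_univ i))
  exact Ideal.mem_of_dvd _ h1 (Ideal.subset_span ⟨i, hi, rfl⟩)

end Regular

theorem regularUpTo_of_isRegular {R : Type*} [CommRing R] {s c : ℕ} (hcs : c < s) {F : Fin s → R}
    (hreg : ∀ e : Fin (c + 1) ↪ Fin s,
      RingTheory.Sequence.IsRegular R (List.ofFn fun a => F (e a))) : RegularUpTo F c := by
  intro Z hZ j hj x hx
  obtain ⟨W, hW, hWc⟩ := Finset.exists_superset_card_eq (s := insert j Z) (n := c + 1)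
    (by rw [Finset.card_insert_of_notMem hj]; omega) (by simpa using hcs)
  -- List `Z` first, then `j`, then padding up to length `c + 1`: regularity at position `|Z|` is
  -- the required statement.
  set L : List (Fin s) := Z.toList ++ j :: (W \ insert j Z).toList with hL
  have hnd : L.Nodup := by
    rw [hL, List.nodup_append', List.nodup_cons]
    refine ⟨Z.nodup_toList, ⟨by simp, Finset.nodup_toList _⟩, ?_⟩
    intro y hy hy'
    rw [Finset.mem_toList] at hy
    rcases List.mem_cons.1 hy' with rfl | h
    · exact hj hy
    · simp [hy] at h
  have hlen : L.length = c + 1 := by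
    rw [hL, List.length_append, List.length_cons, Finset.length_toList, Finset.length_toList,
      Finset.card_sdiff_of_subset hW, hWc, Finset.card_insert_of_notMem hj]
    omega
  let e : Fin (c + 1) ↪ Fin s :=
    ⟨fun a => L.get (a.cast hlen.symm), fun a b h => by
      have := (List.nodup_iff_injective_get.1 hnd) h
      simpa [Fin.ext_iff] using this⟩
  have hofn : (List.ofFn fun a => F (e a)) = L.map F := by
    refine List.ext_get (by simp [hlen]) fun i h1 h2 => ?_
    simp only [List.get_eq_getElem, List.getElem_ofFn, List.getElem_map]
    rfl
  have h := (hreg e).regular_mod_prev Z.card (by rw [hofn, List.length_map, hlen]; omega)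
  have htake : List.take Z.card (List.ofFn fun a => F (e a)) = Z.toList.map F := by
    rw [hofn, hL, List.map_append, List.take_left' (by simp)]
  have hget : (List.ofFn fun a => F (e a))[Z.card]'(by
      rw [hofn, List.length_map, hlen]; omega) = F j := by
    simp only [hofn, hL]
    rw [List.getElem_map, List.getElem_append_right (by simp)]
    simp
  have hspan : Ideal.ofList (Z.toList.map F) = Ideal.span (F '' (Z : Set (Fin s))) := by
    unfold Ideal.ofList
    congr 1
    ext y
    simp
  rw [htake, hget, hspan, isSMulRegular_on_quot_iff_lsmul_comap_le] at h
  have h' := h (x := x) (by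
    rw [Submodule.mem_comap]
    simpa using hx)
  simpa using h'

end StarConfiguration

namespace StarConfiguration

/-! ### Minimal monomial generators and their order. -/

section Generators

variable {s c m : ℕ}

/-- The largest exponent. -/
def topExp (a : Fin s → ℕ) : ℕ := Finset.univ.sup a

/-- The positions of the largest exponent. -/
def topSet (a : Fin s → ℕ) : Finset (Fin s) := Finset.univ.filter fun i => a i = topExp a

/-- The exponents of the monomials lying in the `m`-th powers of all ideals generated by `c` of
the variables. -/
def symExp (s c m : ℕ) : Set (Fin s → ℕ) := {a | ∀ S : Finset (Fin s), S.card = c → m ≤ ∑ i ∈ S, a i}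

/-- The exponents of the minimal monomial generators. -/
def IsGen (c m : ℕ) (a : Fin s → ℕ) : Prop :=
  ∑ i, a i = m + topExp a * (s - c) ∧ s - c + 1 ≤ (topSet a).card

/-- The set of exponents of the minimal monomial generators. -/
noncomputable def gens (s c m : ℕ) : Finset (Fin s → ℕ) := by
  classical exact (Fintype.piFinset fun _ => Finset.range (m + 1)).filter (IsGen c m)

/-- The variables generating the colon ideal of the preceding generators by the generator `a`. -/
def linSet (a : Fin s → ℕ) : Finset (Fin s) :=
  Finset.univ.filter fun i =>
    a i + 2 ≤ topExp a ∨ (a i + 1 = topExp a ∧ ∃ j, j < i ∧ a j = topExp a)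

/-- The order of the generators. -/
def genKey (a : Fin s → ℕ) : ℕ ×ₗ ℕ ×ₗ Lex (Fin s → ℕ) :=
  toLex (topExp a, toLex (∑ i, a i ^ 2, toLex a))

theorem genKey_lt {a b : Fin s → ℕ} : genKey b < genKey a ↔ topExp b < topExp a ∨
    topExp b = topExp a ∧ (∑ i, b i ^ 2 < ∑ i, a i ^ 2 ∨
      ∑ i, b i ^ 2 = ∑ i, a i ^ 2 ∧ ∃ p, (∀ j < p, b j = a j) ∧ b p < a p) := by
  simp only [genKey, Prod.Lex.toLex_lt_toLex]
  rfl

theorem genKey_injective : Function.Injective (genKey (s := s)) := by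
  intro a b h
  simpa [genKey] using (Prod.mk.inj (Prod.mk.inj (toLex.injective h)).2).2

theorem le_topExp (a : Fin s → ℕ) (i : Fin s) : a i ≤ topExp a :=
  Finset.le_sup (Finset.mem_univ i)

theorem mem_topSet {a : Fin s → ℕ} {i : Fin s} : i ∈ topSet a ↔ a i = topExp a := by
  simp [topSet]

theorem topSet_nonempty (hs : 0 < s) (a : Fin s → ℕ) : (topSet a).Nonempty := by
  have : (Finset.univ : Finset (Fin s)).Nonempty := ⟨⟨0, hs⟩, Finset.mem_univ _⟩
  obtain ⟨i, -, hi⟩ := Finset.exists_mem_eq_sup Finset.univ this a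
  exact ⟨i, mem_topSet.2 hi.symm⟩

theorem IsGen.topExp_le {a : Fin s → ℕ} (ha : IsGen c m a) : topExp a ≤ m := by
  have h1 : (topSet a).card * topExp a ≤ ∑ i, a i := by
    rw [← smul_eq_mul, ← Finset.sum_const]
    refine (Finset.sum_le_sum fun i hi => (mem_topSet.1 hi).ge).trans
      (Finset.sum_le_sum_of_subset (Finset.subset_univ _))
  have h2 := Nat.mul_le_mul_right (topExp a) ha.2
  rw [ha.1] at h1
  have := h2.trans h1
  have h3 : (s - c + 1) * topExp a = topExp a * (s - c) + topExp a := by ring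
  omega

theorem mem_gens {a : Fin s → ℕ} : a ∈ gens s c m ↔ IsGen c m a := by
  classical
  simp only [gens, Finset.mem_filter, Fintype.mem_piFinset, Finset.mem_range, and_iff_right_iff_imp]
  intro h i
  have := le_topExp a i
  have := h.topExp_le
  omega

/-- A `c`-set omits `s - c` positions, which carry at most `t (s - c)` of the total. -/
theorem mem_symExp_of_le {a : Fin s → ℕ} {t : ℕ} (hle : ∀ i, a i ≤ t)
    (hsum : m + t * (s - c) ≤ ∑ i, a i) : a ∈ symExp s c m := by
  intro S hS
  have h1 := Finset.sum_add_sum_compl S a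
  have h2 : ∑ i ∈ Sᶜ, a i ≤ (s - c) * t := by
    have := Finset.sum_le_card_nsmul Sᶜ a t fun i _ => hle i
    rwa [Finset.card_compl, Fintype.card_fin, hS, smul_eq_mul] at this
  rw [mul_comm] at h2
  omega

theorem IsGen.mem_symExp {a : Fin s → ℕ} (ha : IsGen c m a) : a ∈ symExp s c m :=
  mem_symExp_of_le (le_topExp a) ha.1.ge

/-- Unless `b` is already a generator, one of its largest exponents can be lowered by one without
leaving `symExp`. -/
theorem exists_isGen_le (hcs : c < s) (hm : 1 ≤ m) {b : Fin s → ℕ} (hb : b ∈ symExp s c m) :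
    ∃ a, IsGen c m a ∧ a ≤ b := by
  induction hN : ∑ i, b i using Nat.strong_induction_on generalizing b with
  | _ N ih =>
  subst hN
  by_cases hgen : IsGen c m b
  · exact ⟨b, hgen, le_rfl⟩
  have htop : 0 < topExp b := by
    by_contra h0
    obtain ⟨S, -, hS⟩ := Finset.exists_subset_card_eq (s := (Finset.univ : Finset (Fin s)))
      (n := c) (by simpa using hcs.le)
    have h1 := hb S hS
    have h2 : ∑ i ∈ S, b i = 0 := Finset.sum_eq_zero fun i _ => by
      have := le_topExp b i
      omega
    omega
  obtain ⟨j, hj⟩ := topSet_nonempty (by omega) b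
  have hj' := mem_topSet.1 hj
  have hle : (fun i => if i = j then b i - 1 else b i) ≤ b := by
    intro i; dsimp only; split_ifs <;> omega
  have hsum : ∀ S : Finset (Fin s), j ∈ S →
      ∑ i ∈ S, (if i = j then b i - 1 else b i) + 1 = ∑ i ∈ S, b i := by
    intro S hS
    rw [← Finset.add_sum_erase S _ hS, ← Finset.add_sum_erase S b hS, if_pos rfl,
      Finset.sum_congr rfl fun i hi => if_neg (Finset.ne_of_mem_erase hi)]
    change b j - 1 + ∑ i ∈ S.erase j, b i + 1 = _
    omega
  suffices h : (fun i => if i = j then b i - 1 else b i) ∈ symExp s c m by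
    have := hsum Finset.univ (Finset.mem_univ j)
    obtain ⟨a, ha, hab⟩ := ih _ (by omega) h rfl
    exact ⟨a, ha, hab.trans hle⟩
  intro S hS
  by_cases hjS : j ∈ S
  swap
  · refine (hb S hS).trans_eq (Finset.sum_congr rfl fun i hi => (if_neg ?_).symm)
    rintro rfl
    exact hjS hi
  have hS1 := hsum S hjS
  suffices h : m + 1 ≤ ∑ i ∈ S, b i by
    change m ≤ ∑ i ∈ S, (if i = j then b i - 1 else b i)
    omega
  -- With enough top positions, omitting `s - c` of them shows that the total is at least `m +
  -- topExp b * (s - c)`. Equality would make `b` a generator, so one unit is spare. With too few,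
  -- some position outside `S` is not maximal, and exchanging `j` for it strictly lowers a sum that
  -- is still at least `m`.
  by_cases hcard : s - c + 1 ≤ (topSet b).card
  · have hne : ∑ i, b i ≠ m + topExp b * (s - c) := fun h => hgen ⟨h, hcard⟩
    obtain ⟨T, hT, hTc⟩ := Finset.exists_subset_card_eq (s := topSet b) (n := s - c) (by omega)
    have h1 := Finset.sum_add_sum_compl T b
    have h2 : ∑ i ∈ T, b i = topExp b * (s - c) := by
      rw [Finset.sum_congr rfl fun i hi => mem_topSet.1 (hT hi), Finset.sum_const, hTc,
        smul_eq_mul, mul_comm]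
    have h3 := hb Tᶜ (by rw [Finset.card_compl, Fintype.card_fin, hTc]; omega)
    exact mem_symExp_of_le (le_topExp b) (by omega) S hS
  · obtain ⟨l, hlS, hl⟩ : ∃ l, l ∉ S ∧ b l < topExp b := by
      by_contra hcon
      push Not at hcon
      have hsub : insert j Sᶜ ⊆ topSet b := by
        intro i hi
        rcases Finset.mem_insert.1 hi with rfl | hi
        · exact hj
        · exact mem_topSet.2 ((le_topExp b i).antisymm (hcon i (Finset.mem_compl.1 hi)))
      have := Finset.card_le_card hsub
      rw [Finset.card_insert_of_notMem (by simpa using hjS), Finset.card_compl, Fintype.card_fin,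
        hS] at this
      omega
    have hlS' : l ∉ S.erase j := fun h => hlS (Finset.mem_of_mem_erase h)
    have h1 := hb (insert l (S.erase j)) (by
      rw [Finset.card_insert_of_notMem hlS', Finset.card_erase_of_mem hjS, hS]
      have : 0 < S.card := Finset.card_pos.2 ⟨j, hjS⟩
      omega)
    rw [Finset.sum_insert hlS'] at h1
    have h2 := Finset.add_sum_erase S b hjS
    omega

theorem IsGen.topExp_pos (hm : 1 ≤ m) {a : Fin s → ℕ} (ha : IsGen c m a) : 0 < topExp a := by
  by_contra h0
  have h2 : ∑ i, a i = 0 := Finset.sum_eq_zero fun i _ => by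
    have := le_topExp a i
    omega
  have := ha.1
  omega

/-- `linSet a` avoids the top positions, of which there are at least `s - c + 1`. The bound `c - 1`,
rather than `c`, leaves room for the extra form used in the depth argument. -/
theorem IsGen.card_linSet (hcs : c < s) {a : Fin s → ℕ} (ha : IsGen c m a) :
    (linSet a).card + 1 ≤ c := by
  have h : linSet a ⊆ (topSet a)ᶜ := by
    intro i hi
    rw [Finset.mem_compl, mem_topSet]
    simp only [linSet, Finset.mem_filter] at hi
    omega
  have h1 := Finset.card_le_card h
  have h2 := ha.2
  have h3 := Finset.card_le_univ (topSet a)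
  rw [Finset.card_compl, Fintype.card_fin] at h1
  rw [Fintype.card_fin] at h3
  omega

theorem notMem_linSet {a : Fin s → ℕ} {i : Fin s} (h : i ∉ linSet a) :
    a i = topExp a ∨ (a i + 1 = topExp a ∧ ∀ j < i, a j ≠ topExp a) := by
  simp only [linSet, Finset.mem_filter, Finset.mem_univ, true_and, not_or, not_and, not_exists]
    at h
  have := le_topExp a i
  by_cases h1 : a i = topExp a
  · exact Or.inl h1
  · have h2 : a i + 1 = topExp a := by omega
    exact Or.inr ⟨h2, h.2 h2⟩

/-- This bounds the colon ideal from above: every earlier generator exceeds `a` somewhere on `linSet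
a`. -/
theorem IsGen.exists_lt_of_genKey_lt {a b : Fin s → ℕ} (ha : IsGen c m a)
    (hb : IsGen c m b) (hlt : genKey b < genKey a) : ∃ i ∈ linSet a, a i < b i := by
  by_contra hcon
  push Not at hcon
  rcases genKey_lt.1 hlt with htop | ⟨htop, hlt⟩
  -- Smaller maximum: off `linSet a` the exponents of `a` are at least `topExp a - 1 ≥ topExp b`, so
  -- `b ≤ a` everywhere. Outside `s - c` top positions of `a`, the exponents of `a` sum to `m` and
  -- those of `b` to at least `m`, yet a further top position makes the inequality strict.
  · obtain ⟨T, hT, hTc⟩ := Finset.exists_subset_card_eq (s := topSet a) (n := s - c)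
      (by have := ha.2; omega)
    have hTa : ∑ i ∈ T, a i = topExp a * (s - c) := by
      rw [Finset.sum_congr rfl fun i hi => mem_topSet.1 (hT hi), Finset.sum_const, hTc,
        smul_eq_mul, mul_comm]
    have hTb : ∑ i ∈ T, b i ≤ topExp b * (s - c) := by
      have := Finset.sum_le_card_nsmul T b _ fun i _ => le_topExp b i
      rwa [hTc, smul_eq_mul, mul_comm] at this
    obtain ⟨l, hl, hlT⟩ : ∃ l ∈ topSet a, l ∉ T := Finset.exists_mem_notMem_of_card_lt_card
      (by have := ha.2; omega)
    have hlt : ∑ i ∈ Tᶜ, b i < ∑ i ∈ Tᶜ, a i := by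
      refine Finset.sum_lt_sum (fun i _ => ?_) ⟨l, by simpa using hlT, ?_⟩
      · by_cases hi : i ∈ linSet a
        · exact hcon i hi
        · have := le_topExp b i
          rcases notMem_linSet hi with h | h <;> omega
      · have := le_topExp b l
        rw [mem_topSet.1 hl]
        omega
    have h1 := Finset.sum_add_sum_compl T a
    have h2 := Finset.sum_add_sum_compl T b
    have := ha.1
    have := hb.1
    omega
  · have hsum : ∑ i, b i = ∑ i, a i := by rw [ha.1, hb.1, htop]
    set t := topExp a with ht
    have hbt : ∀ i, b i ≤ t := fun i => htop ▸ le_topExp b i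
    -- The term is the difference at `b i` and `a i` of `x² - (2t - 1)x`, which decreases on
    -- integers up to `t - 1` and is minimal at both `t - 1` and `t`. As the linear parts cancel in
    -- total, the terms add up to `∑ b² - ∑ a² ≤ 0`, so each of them vanishes.
    have hterm : ∀ i, 0 ≤ ((b i : ℤ) - a i) * (b i + a i - (2 * t - 1)) := by
      intro i
      have hbi := hbt i
      by_cases hi : i ∈ linSet a
      · have h1 := hcon i hi
        have h2 : a i + 1 ≤ t := by
          simp only [linSet, Finset.mem_filter] at hi
          omega
        zify at h1 h2 hbi
        nlinarith
      · rcases notMem_linSet hi with h | h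
        · rw [h, ← ht]
          rcases hbi.eq_or_lt with h' | h'
          · simp [h']
          · zify at h'
            nlinarith
        · have h' : (a i : ℤ) = t - 1 := by have := h.1; omega
          rw [h']
          rcases hbi.eq_or_lt with h' | h'
          · rw [h']
            exact le_of_eq (by ring)
          · zify at h'
            nlinarith
    have htot : ∑ i, ((b i : ℤ) - a i) * (b i + a i - (2 * t - 1)) =
        ∑ i, (b i : ℤ) ^ 2 - ∑ i, (a i : ℤ) ^ 2 := by
      have h0 : ∑ i, ((b i : ℤ) - a i) = 0 := by
        rw [Finset.sum_sub_distrib]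
        have : (∑ i, (b i : ℤ)) = ∑ i, (a i : ℤ) := by exact_mod_cast hsum
        rw [this, sub_self]
      rw [← Finset.sum_sub_distrib]
      have : ∀ i, ((b i : ℤ) - a i) * (b i + a i - (2 * t - 1)) =
        ((b i : ℤ) ^ 2 - (a i : ℤ) ^ 2) - (b i - a i) * (2 * t - 1) := fun i => by ring
      simp_rw [this]
      rw [Finset.sum_sub_distrib, ← Finset.sum_mul, h0]
      ring
    have hnn := Finset.sum_nonneg fun i (_ : i ∈ Finset.univ) => hterm i
    rw [htot] at hnn
    have hq : ∑ i, b i ^ 2 = ∑ i, a i ^ 2 ∧ ∃ p, (∀ j < p, b j = a j) ∧ b p < a p := by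
      rcases hlt with h | h
      · zify at h
        omega
      · exact h
    obtain ⟨hq, p, hp, hpl⟩ := hq
    have hz : ∑ i, ((b i : ℤ) - a i) * (b i + a i - (2 * t - 1)) = 0 := by
      rw [htot]
      zify at hq
      omega
    rw [Finset.sum_eq_zero_iff_of_nonneg fun i _ => hterm i] at hz
    -- So `b` differs from `a` only by exchanging values `t` and `t - 1`. The first difference `p`
    -- drops from `t` to `t - 1`, hence a position `l` rising to `t` comes after `p` and belongs to
    -- `linSet a`.
    have hz' : ∀ i, b i = a i ∨ b i + a i + 1 = 2 * t := by
      intro i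
      rcases mul_eq_zero.1 (hz i (Finset.mem_univ i)) with h | h
      · left; omega
      · right; omega
    obtain ⟨l, -, hl⟩ : ∃ l ∈ Finset.univ, a l < b l := by
      by_contra hno
      push Not at hno
      have := Finset.sum_lt_sum hno ⟨p, Finset.mem_univ p, hpl⟩
      omega
    have hll : l ∉ linSet a := fun h => (hcon l h).not_gt hl
    have hap : a p = t := by
      have := hz' p
      have := le_topExp a p
      omega
    rcases notMem_linSet hll with h | ⟨h, h'⟩
    · have := hbt l
      omega
    · rcases lt_trichotomy l p with h1 | h1 | h1
      · have := hp l h1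
        omega
      · subst h1
        omega
      · exact h' p h1 hap

/-- Moving one unit from a top position `j` to `i` preserves the total and does not raise the
maximum, so the result stays in `symExp`. Any generator below it comes before `a`. -/
theorem IsGen.exists_genKey_lt_of_mem_linSet (hcs : c < s) (hm : 1 ≤ m) {a : Fin s → ℕ}
    (ha : IsGen c m a) {i : Fin s} (hi : i ∈ linSet a) :
    ∃ b, IsGen c m b ∧ genKey b < genKey a ∧ b ≤ a + Pi.single i 1 := by
  have hpos := ha.topExp_pos hm
  obtain ⟨j, hj, hcase⟩ : ∃ j, a j = topExp a ∧
      (a i + 2 ≤ topExp a ∨ (a i + 1 = topExp a ∧ j < i)) := by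
    simp only [linSet, Finset.mem_filter, Finset.mem_univ, true_and] at hi
    rcases hi with h | ⟨h, j, hji, hj⟩
    · obtain ⟨j, hj⟩ := topSet_nonempty (by omega) a
      exact ⟨j, mem_topSet.1 hj, Or.inl h⟩
    · exact ⟨j, hj, Or.inr ⟨h, hji⟩⟩
  have hij : i ≠ j := by
    rintro rfl
    omega
  set t := topExp a with ht
  let b : Fin s → ℕ := fun l => if l = i then a i + 1 else if l = j then t - 1 else a l
  have hbi : b i = a i + 1 := if_pos rfl
  have hbj : b j = t - 1 := (if_neg hij.symm).trans (if_pos rfl)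
  have hbl : ∀ l, l ≠ i → l ≠ j → b l = a l := fun l h1 h2 =>
    (if_neg h1).trans (if_neg h2)
  have hbt : ∀ l, b l ≤ t := by
    intro l
    have := le_topExp a l
    simp only [b]
    split_ifs <;> omega
  have hZ : ∀ l, (b l : ℤ) = a l + (if l = i then 1 else 0) - (if l = j then 1 else 0) := by
    intro l
    by_cases h1 : l = i
    · subst h1
      rw [hbi, if_pos rfl, if_neg hij]; push_cast; ring
    · by_cases h2 : l = j
      · subst h2
        rw [hbj, if_neg h1, if_pos rfl, hj]; push_cast [hpos]; ring
      · rw [hbl l h1 h2, if_neg h1, if_neg h2]; ring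
  have hsum : ∑ l, b l = ∑ l, a l := by
    zify
    simp_rw [hZ]
    simp [Finset.sum_sub_distrib, Finset.sum_add_distrib]
  -- The sum of squares drops if `a i ≤ t - 2`. If `a i = t - 1` it is unchanged, and `j < i` makes
  -- `b` lexicographically smaller.
  have hsq : ∑ l, (b l : ℤ) ^ 2 = ∑ l, (a l : ℤ) ^ 2 + 2 * (a i + 1 - t) := by
    have : ∀ l, (b l : ℤ) ^ 2 = a l ^ 2 + (if l = i then 2 * (a l : ℤ) + 1 else 0) -
        (if l = j then 2 * (a l : ℤ) - 1 else 0) := by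
      intro l
      rw [hZ]
      by_cases h1 : l = i
      · subst h1
        rw [if_pos rfl, if_neg hij, if_pos rfl, if_neg hij]; ring
      · by_cases h2 : l = j
        · subst h2
          rw [if_neg h1, if_pos rfl, if_neg h1, if_pos rfl]; ring
        · rw [if_neg h1, if_neg h2, if_neg h1, if_neg h2]; ring
    simp_rw [this]
    simp only [Finset.sum_sub_distrib, Finset.sum_add_distrib, Finset.sum_ite_eq',
      Finset.mem_univ, if_true]
    rw [hj]
    ring
  have hbM : b ∈ symExp s c m := mem_symExp_of_le hbt (by rw [hsum]; exact ha.1.ge)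
  obtain ⟨g, hg, hgb⟩ := exists_isGen_le hcs hm hbM
  have hgt : topExp g ≤ t := Finset.sup_le fun l _ => (hgb l).trans (hbt l)
  refine ⟨g, hg, ?_, hgb.trans fun l => ?_⟩
  swap
  · by_cases h1 : l = i
    · subst h1; simp [hbi]
    · by_cases h2 : l = j
      · subst h2; rw [hbj, Pi.add_apply, hj]; exact (Nat.sub_le _ _).trans (Nat.le_add_right _ _)
      · rw [hbl l h1 h2, Pi.add_apply]; exact Nat.le_add_right _ _
  rw [genKey_lt]
  rcases hgt.lt_or_eq with h | h
  · exact Or.inl h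
  · refine Or.inr ⟨h, ?_⟩
    have hgbsum : ∑ l, g l = ∑ l, b l := by rw [hg.1, hsum, ha.1, h]
    have hgb' : g = b := by
      funext l
      exact (Finset.sum_eq_sum_iff_of_le fun l _ => hgb l).1 hgbsum l (Finset.mem_univ l)
    subst hgb'
    rcases hcase with h1 | ⟨h1, h2⟩
    · left
      zify
      rw [hsq]
      omega
    · right
      refine ⟨?_, j, fun l hl => ?_, ?_⟩
      · zify
        rw [hsq]
        omega
      · exact hbl l (hl.trans h2).ne hl.ne
      · omega

/-- Induction along the order of the generators. -/
theorem induction_on_genKey (G : Finset (Fin s → ℕ)) {P : Finset (Fin s → ℕ) → Prop}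
    (h0 : P ∅)
    (h1 : ∀ a E, a ∈ G → (∀ b, b ∈ E ↔ b ∈ G ∧ genKey b < genKey a) → P E → P (insert a E)) :
    P G := by
  suffices h : ∀ E : Finset (Fin s → ℕ), E ⊆ G →
      (∀ x ∈ E, ∀ y ∈ G, genKey y < genKey x → y ∈ E) → P E from
    h G subset_rfl fun _ _ y hy _ => hy
  intro E
  induction E using Finset.induction_on_max_value genKey with
  | empty => exact fun _ _ => h0
  | insert a E haE hmax ih =>
    intro hEG hlow
    have hsub : E ⊆ G := (Finset.subset_insert a E).trans hEG
    refine h1 a E (hEG (Finset.mem_insert_self a E)) (fun b => ⟨fun hb => ⟨hsub hb, ?_⟩, ?_⟩)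
      (ih hsub fun x hx y hy hyx => ?_)
    · refine (hmax b hb).lt_of_ne fun h => haE ?_
      rwa [← genKey_injective h]
    · rintro ⟨hb, hlt⟩
      refine Finset.mem_of_mem_insert_of_ne (hlow a (Finset.mem_insert_self a E) b hb hlt) ?_
      rintro rfl
      exact lt_irrefl _ hlt
    · refine Finset.mem_of_mem_insert_of_ne (hlow x (Finset.mem_insert_of_mem hx) y hy hyx) ?_
      rintro rfl
      exact (hmax x hx).not_gt hyx

end Generators

end StarConfiguration

namespace StarConfiguration

/-! ### Linear quotients. -/

section LinearQuotients

variable {R : Type*} [CommRing R] {s c m : ℕ} {F : Fin s → R}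

theorem mem_span_linSet_iff (hcs : c < s) (hm : 1 ≤ m) (hreg : RegularUpTo F c)
    {a : Fin s → ℕ} (ha : a ∈ gens s c m) {E : Finset (Fin s → ℕ)}
    (hE : ∀ b, b ∈ E ↔ b ∈ gens s c m ∧ genKey b < genKey a) (x : R) :
    x ∈ Ideal.span (F '' (linSet a : Set (Fin s))) ↔ mon F a * x ∈ monIdeal F (E : Set _) := by
  have hga := mem_gens.1 ha
  constructor
  · suffices h : Ideal.span (F '' (linSet a : Set (Fin s))) ≤
        Submodule.comap (LinearMap.mulLeft _ (mon F a)) (monIdeal F (E : Set _)) from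
      fun hx => h hx
    rw [Ideal.span_le]
    rintro _ ⟨i, hi, rfl⟩
    obtain ⟨b, hb, hlt, hle⟩ := hga.exists_genKey_lt_of_mem_linSet hcs hm hi
    have := mon_mem_monIdeal (F := F) (E := E) ((hE b).2 ⟨mem_gens.2 hb, hlt⟩) hle
    rwa [mon_add, mon_single, pow_one] at this
  · have := hga.card_linSet hcs
    refine hreg.mem_span_of_mon_mul_mem (by omega) fun b hb => ?_
    obtain ⟨hb, hlt⟩ := (hE b).1 hb
    exact hga.exists_lt_of_genKey_lt (mem_gens.1 hb) hlt

end LinearQuotients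

/-! ### Resolution by iterated mapping cones. -/

section Betti

open MvPolynomial

attribute [local instance] MvPolynomial.gradedAlgebra

variable {σ k : Type*} [Field k] {s c m δ : ℕ} {F : Fin s → MvPolynomial σ k}

theorem mon_isHomogeneous (hF : ∀ j, (F j).IsHomogeneous δ) (a : Fin s → ℕ) :
    (mon F a).IsHomogeneous (δ * ∑ i, a i) := by
  rw [Finset.mul_sum]
  exact IsHomogeneous.prod _ _ _ fun i _ => (hF i).pow (a i)

theorem isHomogeneous_monIdeal (hF : ∀ j, (F j).IsHomogeneous δ) (E : Set (Fin s → ℕ)) :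
    (monIdeal F E).IsHomogeneous (homogeneousSubmodule σ k) := by
  refine Ideal.homogeneous_span _ _ ?_
  rintro _ ⟨a, -, rfl⟩
  exact ⟨_, mon_isHomogeneous hF a⟩

theorem isHomogeneous_span_image (hF : ∀ j, (F j).IsHomogeneous δ) (Z : Set (Fin s)) :
    (Ideal.span (F '' Z)).IsHomogeneous (homogeneousSubmodule σ k) := by
  refine Ideal.homogeneous_span _ _ ?_
  rintro _ ⟨a, -, rfl⟩
  exact ⟨_, hF a⟩

/-- The Betti numbers of a complete intersection of at most `c + 1` of the forms. -/
theorem exists_resolution_span_image (hreg : RegularUpTo F c)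
    (hF : ∀ j, (F j).IsHomogeneous δ) (hδ : 0 < δ) (Z : Finset (Fin s)) (hZ : Z.card ≤ c + 1) :
    ∃ C : MinimalGradedFreeResolution (Ideal.span (F '' (Z : Set (Fin s)))),
      ∀ p j, C.betti p j = if j = δ * p then Z.card.choose p else 0 := by
  induction Z using Finset.induction_on with
  | empty =>
    rw [Finset.coe_empty, Set.image_empty, Ideal.span_empty]
    obtain ⟨C, hC⟩ := MinimalGradedFreeResolution.exists_bot (σ := σ) (k := k)
    refine ⟨C, fun p j => ?_⟩
    rw [hC]
    cases p with
    | zero => simp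
    | succ p => simp
  | insert i Z hi ih =>
    rw [Finset.card_insert_of_notMem hi] at hZ ⊢
    obtain ⟨B, hB⟩ := ih (by omega)
    rw [Finset.coe_insert, Set.image_insert_eq, Ideal.span_insert, sup_comm]
    have hdeg : ∀ p b, B.deg p b = δ * p := by
      intro p b
      by_contra h
      have := B.betti_pos p b
      rw [hB, if_neg h] at this
      omega
    -- `F i` is regular modulo the forms in `Z`, so the colon ideal is the ideal itself and `B`
    -- plays both roles.
    obtain ⟨C, hC0, hC⟩ := MinimalGradedFreeResolution.exists_cone B B
      (isHomogeneous_span_image hF _) (hF i)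
      (fun x => ⟨fun hx => Ideal.mul_mem_left _ _ hx, hreg Z (by omega) i hi x⟩)
      (fun p a b => by rw [hdeg, hdeg]; omega)
    refine ⟨C, fun p j => ?_⟩
    cases p with
    | zero => rw [hC0, hB]; simp
    | succ p =>
      rw [hC, hB, hB, Nat.choose_succ_succ, mul_add, mul_one]
      by_cases h : j = δ * p + δ
      · rw [if_pos h, if_pos (by omega), if_pos (by omega), if_pos h, add_comm]
      · rw [if_neg h, if_neg h]
        split_ifs <;> omega

/-- The Betti numbers of the monomial ideal with linear quotients generated by `gens s c m`. -/
theorem exists_resolution_gens (hcs : c < s) (hm : 1 ≤ m) (hreg : RegularUpTo F c)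
    (hF : ∀ j, (F j).IsHomogeneous δ) (hδ : 0 < δ) :
    ∃ C : MinimalGradedFreeResolution (monIdeal F (gens s c m : Set _)),
      ∀ p j, C.betti (p + 1) j = ∑ a ∈ gens s c m,
        if j = δ * (∑ i, a i + p) then (linSet a).card.choose p else 0 := by
  suffices h : ∃ C : MinimalGradedFreeResolution (monIdeal F (gens s c m : Set _)),
      (∀ j, C.betti 0 j = if j = 0 then 1 else 0) ∧
      ∀ p j, C.betti (p + 1) j = ∑ a ∈ gens s c m,
        if j = δ * (∑ i, a i + p) then (linSet a).card.choose p else 0 by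
    obtain ⟨C, -, hC⟩ := h
    exact ⟨C, hC⟩
  refine induction_on_genKey (gens s c m) (P := fun E =>
    ∃ C : MinimalGradedFreeResolution (monIdeal F (E : Set _)),
      (∀ j, C.betti 0 j = if j = 0 then 1 else 0) ∧
      ∀ p j, C.betti (p + 1) j = ∑ a ∈ E,
        if j = δ * (∑ i, a i + p) then (linSet a).card.choose p else 0) ?_ ?_
  · rw [Finset.coe_empty, monIdeal, Set.image_empty, Ideal.span_empty]
    obtain ⟨C, hC⟩ := MinimalGradedFreeResolution.exists_bot (σ := σ) (k := k)
    exact ⟨C, fun j => by rw [hC]; simp, fun p j => by rw [hC]; simp⟩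
  · intro a E ha hE hPE
    obtain ⟨B, hB0, hB⟩ := hPE
    have hga := mem_gens.1 ha
    have hcard := hga.card_linSet hcs
    obtain ⟨A, hA⟩ := exists_resolution_span_image hreg hF hδ (linSet a) (by omega)
    have hapos : 0 < ∑ i, a i := by rw [hga.1]; omega
    have hAdeg : ∀ p b, A.deg p b = δ * p := by
      intro p b
      by_contra h
      have := A.betti_pos p b
      rw [hA, if_neg h] at this
      omega
    rw [Finset.coe_insert, monIdeal_insert]
    -- Earlier generators have no larger maximum, hence no larger total degree; the shift in
    -- homological degree by one makes the comparison of degrees strict.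
    obtain ⟨C, hC0, hC⟩ := MinimalGradedFreeResolution.exists_cone A B
      (isHomogeneous_monIdeal hF _) (mon_isHomogeneous hF a)
      (mem_span_linSet_iff hcs hm hreg ha hE) (fun p x y => by
        rw [hAdeg, ← mul_add]
        cases p with
        | zero =>
          have : B.deg 0 y = 0 := by
            by_contra h
            have := B.betti_pos 0 y
            rw [hB0, if_neg h] at this
            omega
          rw [this]
          exact Nat.mul_pos hδ (by omega)
        | succ p =>
          have := B.betti_pos (p + 1) y
          rw [hB] at this
          obtain ⟨b, hb, hne⟩ := Finset.exists_ne_zero_of_sum_ne_zero this.ne'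
          have hy : B.deg (p + 1) y = δ * (∑ i, b i + p) := by
            by_contra h
            rw [if_neg h] at hne
            exact hne rfl
          rw [hy]
          obtain ⟨hb, hlt⟩ := (hE b).1 hb
          have htop : topExp b ≤ topExp a := by
            rcases genKey_lt.1 hlt with h | h
            · exact h.le
            · exact h.1.le
          have hsum : ∑ i, b i ≤ ∑ i, a i := by
            rw [hga.1, (mem_gens.1 hb).1]
            have := Nat.mul_le_mul_right (s - c) htop
            omega
          exact Nat.mul_lt_mul_of_pos_left (by omega) hδ)
    refine ⟨C, fun j => by rw [hC0, hB0], fun p j => ?_⟩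
    have haE : a ∉ E := fun h => lt_irrefl _ ((hE a).1 h).2
    rw [hC, hB, hA, Finset.sum_insert haE, add_comm]
    congr 1
    rw [mul_add]
    by_cases h : j = δ * ∑ i, a i + δ * p
    · rw [if_pos h, if_pos (by omega), if_pos (by omega)]
    · rw [if_neg h]
      split_ifs <;> omega

end Betti

/-! ### Symbolic powers as monomial ideals. -/

section SymbolicPower

variable {R : Type*} [CommRing R] {s c m : ℕ} {F : Fin s → R}

theorem monIdeal_symExp (hcs : c < s) (hm : 1 ≤ m) :
    monIdeal F (symExp s c m) = monIdeal F (gens s c m : Set _) := by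
  refine le_antisymm ?_ ?_
  · rw [monIdeal, Ideal.span_le]
    rintro _ ⟨b, hb, rfl⟩
    obtain ⟨a, ha, hab⟩ := exists_isGen_le hcs hm hb
    exact mon_mem_monIdeal (mem_gens.2 ha) hab
  · rw [monIdeal, Ideal.span_le]
    rintro _ ⟨b, hb, rfl⟩
    exact mon_mem_monIdeal (mem_gens.1 hb).mem_symExp le_rfl

/-- An elementwise depth count in `0 → R/(F_Z) → R/J → R/(J + (f)) → 0`: depth two on the left and
depth one in the middle give depth one on the right. -/
theorem mem_sup_span_of_pow_mul_mem (hreg : RegularUpTo F c) {J : Ideal R} {f : R}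
    {Z : Finset (Fin s)} (hZ : Z.card + 1 ≤ c)
    (hcolon : ∀ x, x ∈ Ideal.span (F '' (Z : Set (Fin s))) ↔ f * x ∈ J)
    {U : Finset (Fin s)} (hU : U.card = c + 1) {e : ℕ}
    (ih : ∀ h, (∀ j ∈ U, F j ^ e * h ∈ J) → h ∈ J) {h : R}
    (hh : ∀ j ∈ U, F j ^ e * h ∈ J ⊔ Ideal.span {f}) : h ∈ J ⊔ Ideal.span {f} := by
  have hdec : ∀ j, ∃ u z, j ∈ U → u ∈ J ∧ F j ^ e * h = u + f * z := by
    intro j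
    by_cases hj : j ∈ U
    · obtain ⟨u, hu, v, hv, huv⟩ := Submodule.mem_sup.1 (hh j hj)
      obtain ⟨z, rfl⟩ := Ideal.mem_span_singleton.1 hv
      exact ⟨u, z, fun _ => ⟨hu, huv.symm⟩⟩
    · exact ⟨0, 0, fun h => absurd h hj⟩
  choose u z huz using hdec
  have hone : Ideal.span (F '' (Z : Set (Fin s))) = powIdeal F Z 1 :=
    (powIdeal_one fun _ _ => rfl).symm
  rw [hone] at hcolon
  -- Modulo `(F_Z)` the `z j` form a cocycle. Two indices of `U` outside `Z` form a regular sequence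
  -- there, so `z l = F l ^ e * w` for one `w`, and `h - f * w` falls under the hypothesis on `J`.
  have hcomp : ∀ i ∈ U, ∀ j ∈ U, F i ^ e * z j - F j ^ e * z i ∈ powIdeal F Z 1 := by
    intro i hi j hj
    rw [hcolon]
    have : f * (F i ^ e * z j - F j ^ e * z i) = F j ^ e * u i - F i ^ e * u j := by
      linear_combination F j ^ e * (huz i hi).2 - F i ^ e * (huz j hj).2
    rw [this]
    exact Ideal.sub_mem _ (Ideal.mul_mem_left _ _ (huz i hi).1)
      (Ideal.mul_mem_left _ _ (huz j hj).1)
  obtain ⟨i, hi, j, hj, hij⟩ : ∃ i ∈ U \ Z, ∃ j ∈ U \ Z, i ≠ j := by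
    refine Finset.one_lt_card.1 ?_
    have := Finset.le_card_sdiff Z U
    omega
  rw [Finset.mem_sdiff] at hi hj
  have hiZ : (insert i Z).erase i = Z := Finset.erase_insert hi.2
  obtain ⟨w, y, hy, hzi⟩ : ∃ w, ∃ y ∈ powIdeal F Z 1, z i = w * F i ^ e + y := by
    have h1 := hcomp i hi.1 j hj.1
    have h2 : F j ^ e * z i ∈ powIdeal F (insert i Z) (Function.update 1 i e) := by
      rw [mem_powIdeal_update (Finset.mem_insert_self i Z), hiZ]
      exact ⟨z j, _, neg_mem h1, by ring⟩
    have h3 := hreg.mem_powIdeal_of_pow_mul_mem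
      (by rw [Finset.card_insert_of_notMem hi.2]; omega)
      (by rw [Finset.mem_insert, not_or]; exact ⟨hij.symm, hj.2⟩) h2
    rwa [mem_powIdeal_update (Finset.mem_insert_self i Z), hiZ] at h3
  have hw : ∀ l ∈ U, z l - F l ^ e * w ∈ powIdeal F Z 1 := by
    intro l hl
    refine hreg.mem_powIdeal_of_pow_mul_mem (by omega) hi.2 (e := e) ?_
    have : F i ^ e * (z l - F l ^ e * w) = (F i ^ e * z l - F l ^ e * z i) + F l ^ e * y := by
      rw [hzi]; ring
    rw [this]
    exact Ideal.add_mem _ (hcomp i hi.1 l hl) (Ideal.mul_mem_left _ _ hy)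
  have hfin : h - f * w ∈ J := by
    refine ih _ fun l hl => ?_
    have : F l ^ e * (h - f * w) = u l + f * (z l - F l ^ e * w) := by
      linear_combination (huz l hl).2
    rw [this]
    exact Ideal.add_mem _ (huz l hl).1 ((hcolon _).1 (hw l hl))
  rw [← sub_add_cancel h (f * w)]
  exact Ideal.add_mem _ (Ideal.mem_sup_left hfin)
    (Ideal.mem_sup_right (Ideal.mul_mem_right _ _ (Ideal.mem_span_singleton_self _)))

/-- The quotient by the ideal of the generators has depth at least one with respect to the powers
of `c + 1` of the elements. -/
theorem mem_monIdeal_of_pow_mul_mem (hcs : c < s) (hm : 1 ≤ m) (hreg : RegularUpTo F c)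
    {U : Finset (Fin s)} (hU : U.card = c + 1) {e : ℕ} {h : R}
    (hh : ∀ j ∈ U, F j ^ e * h ∈ monIdeal F (symExp s c m)) :
    h ∈ monIdeal F (symExp s c m) := by
  rw [monIdeal_symExp hcs hm] at hh ⊢
  refine induction_on_genKey (gens s c m) (P := fun E => ∀ h : R,
    (∀ j ∈ U, F j ^ e * h ∈ monIdeal F (E : Set (Fin s → ℕ))) →
      h ∈ monIdeal F (E : Set (Fin s → ℕ))) ?_ ?_ h hh
  · intro h hh
    obtain ⟨j, hj⟩ : U.Nonempty := Finset.card_pos.1 (by omega)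
    have h1 : monIdeal F ((∅ : Finset (Fin s → ℕ)) : Set _) = powIdeal F ∅ 1 := by
      simp [monIdeal, powIdeal]
    have := hh j hj
    rw [h1] at this ⊢
    exact hreg.mem_powIdeal_of_pow_mul_mem (by simp) (Finset.notMem_empty j) this
  · intro a E ha hE ih h hh
    rw [Finset.coe_insert, monIdeal_insert] at hh ⊢
    exact mem_sup_span_of_pow_mul_mem hreg ((mem_gens.1 ha).card_linSet hcs)
      (mem_span_linSet_iff hcs hm hreg ha hE) hU ih hh

/-- The exponent vector with value `e` on `T` and zero elsewhere. -/
def indExp (T : Finset (Fin s)) (e : ℕ) : Fin s → ℕ := fun i => if i ∈ T then e else 0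

theorem mon_indExp_insert {T : Finset (Fin s)} {j : Fin s} (hj : j ∉ T) (e : ℕ) :
    mon F (indExp (insert j T) e) = F j ^ e * mon F (indExp T e) := by
  rw [← mon_single, ← mon_add]
  congr 1
  funext i
  by_cases h : i = j
  · subst h; simp [indExp, hj]
  · simp [indExp, Finset.mem_insert, h]

theorem mon_mem_span_pow {S : Finset (Fin s)} {a : Fin s → ℕ} {e : ℕ} (h : e ≤ ∑ i ∈ S, a i) :
    mon F a ∈ Ideal.span (F '' (S : Set (Fin s))) ^ e := by
  refine Ideal.pow_le_pow_right h ?_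
  rw [mon, ← Finset.prod_mul_prod_compl S, ← Finset.prod_pow_eq_pow_sum]
  refine Ideal.mul_mem_right _ _ (Ideal.prod_mem_prod fun i hi => ?_)
  exact Ideal.pow_mem_pow (Ideal.subset_span (Set.mem_image_of_mem F (Finset.mem_coe.2 hi))) _

/-- The exponent vectors of total degree `e` supported on `S`. -/
def degExp (S : Finset (Fin s)) (e : ℕ) : Finset (Fin s → ℕ) :=
  (Fintype.piFinset fun _ => Finset.range (e + 1)).filter fun a =>
    (∀ i, i ∉ S → a i = 0) ∧ ∑ i, a i = e

theorem mem_degExp {S : Finset (Fin s)} {e : ℕ} {a : Fin s → ℕ} :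
    a ∈ degExp S e ↔ (∀ i, i ∉ S → a i = 0) ∧ ∑ i, a i = e := by
  simp only [degExp, Finset.mem_filter, Fintype.mem_piFinset, Finset.mem_range,
    and_iff_right_iff_imp]
  rintro ⟨-, h⟩ i
  have := Finset.single_le_sum (fun i _ => Nat.zero_le (a i)) (Finset.mem_univ i)
  omega

theorem sum_eq_of_mem_degExp {S : Finset (Fin s)} {e : ℕ} {a : Fin s → ℕ} (ha : a ∈ degExp S e) :
    ∑ i ∈ S, a i = e := by
  rw [mem_degExp] at ha
  rw [← ha.2]
  exact Finset.sum_subset (Finset.subset_univ S) fun i _ hi => ha.1 i hi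

theorem span_pow_le_monIdeal (S : Finset (Fin s)) (e : ℕ) :
    Ideal.span (F '' (S : Set (Fin s))) ^ e ≤ monIdeal F (degExp S e : Set _) := by
  induction e with
  | zero =>
    have : (1 : R) ∈ monIdeal F (degExp S 0 : Set _) := by
      rw [← mon_zero (F := F)]
      exact mon_mem_monIdeal (b := 0) (by rw [Finset.mem_coe, mem_degExp]; simp) le_rfl
    rw [(Ideal.eq_top_iff_one _).2 this]
    exact le_top
  | succ e ih =>
    rw [pow_succ]
    refine (Ideal.mul_mono_left ih).trans ?_
    rw [monIdeal, Ideal.span_mul_span, Ideal.span_le]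
    rintro _ ⟨_, ⟨a, ha, rfl⟩, _, ⟨i, hi, rfl⟩, rfl⟩
    rw [Finset.mem_coe, mem_degExp] at ha
    have : mon F a * F i = mon F (a + Pi.single i 1) := by rw [mon_add, mon_single, pow_one]
    dsimp only
    rw [this]
    refine mon_mem_monIdeal ?_ le_rfl
    rw [Finset.mem_coe, mem_degExp]
    refine ⟨fun l hl => ?_, ?_⟩
    · have : l ≠ i := fun h => hl (h ▸ hi)
      simp [ha.1 l hl, Pi.single_eq_of_ne this]
    · simp [Finset.sum_add_distrib, ha.2]

theorem exists_mem_notMem_of_card_eq {S S' : Finset (Fin s)} (h : S.card = S'.card)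
    (hne : S ≠ S') : ∃ j ∈ S', j ∉ S := by
  by_contra hcon
  push Not at hcon
  exact hne (Finset.eq_of_subset_of_card_le hcon h.le).symm

/-- For `|T| = s - c`, multiplying `g` by the `m`-th powers of the forms in `T` gives an element of
the monomial ideal: `g` is in the `m`-th power for the `c`-set `Tᶜ`, and every other `c`-set meets
`T`. The depth statement then removes the elements of `T` one by one. -/
theorem iInf_span_pow_eq (hcs : c < s) (hm : 1 ≤ m) (hreg : RegularUpTo F c) :
    (⨅ S : {S : Finset (Fin s) // S.card = c}, Ideal.span (F '' (S.1 : Set (Fin s))) ^ m) =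
      monIdeal F (symExp s c m) := by
  refine le_antisymm ?_ (le_iInf fun S => ?_)
  · intro g hg
    have hg' : ∀ S : Finset (Fin s), S.card = c → g ∈ Ideal.span (F '' (S : Set (Fin s))) ^ m :=
      fun S hS => (Submodule.mem_iInf _).1 hg ⟨S, hS⟩
    have key : ∀ d, ∀ T : Finset (Fin s), T.card + d = s - c →
        mon F (indExp T m) * g ∈ monIdeal F (symExp s c m) := by
      intro d
      induction d with
      | zero =>
        intro T hT
        have hTc : Tᶜ.card = c := by rw [Finset.card_compl, Fintype.card_fin]; omega
        have h1 := span_pow_le_monIdeal _ _ (hg' Tᶜ hTc)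
        have hle : monIdeal F (degExp Tᶜ m : Set _) ≤ Submodule.comap
            (LinearMap.mulLeft _ (mon F (indExp T m))) (monIdeal F (symExp s c m)) := by
          rw [monIdeal, Ideal.span_le]
          rintro _ ⟨a, ha, rfl⟩
          change mon F (indExp T m) * mon F a ∈ monIdeal F (symExp s c m)
          rw [← mon_add]
          refine mon_mem_monIdeal (fun S hS => ?_) le_rfl
          by_cases hST : Tᶜ = S
          · subst hST
            rw [← sum_eq_of_mem_degExp ha]
            exact Finset.sum_le_sum fun i _ => Nat.le_add_left _ _
          · obtain ⟨j, hj, hjT⟩ := exists_mem_notMem_of_card_eq (hTc.trans hS.symm) hST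
            rw [Finset.notMem_compl] at hjT
            refine le_trans ?_ (Finset.single_le_sum (fun i _ => Nat.zero_le _) hj)
            simp [indExp, hjT]
        exact hle h1
      | succ d ih =>
        intro T hT
        obtain ⟨U, hUT, hU⟩ := Finset.exists_subset_card_eq (s := Tᶜ) (n := c + 1)
          (by rw [Finset.card_compl, Fintype.card_fin]; omega)
        refine mem_monIdeal_of_pow_mul_mem hcs hm hreg hU (e := m) fun j hj => ?_
        have hjT : j ∉ T := Finset.mem_compl.1 (hUT hj)
        rw [← mul_assoc, ← mon_indExp_insert hjT]
        exact ih _ (by rw [Finset.card_insert_of_notMem hjT]; omega)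
    have h := key (s - c) ∅ (by simp)
    have h0 : indExp (∅ : Finset (Fin s)) m = 0 := by funext i; simp [indExp]
    rwa [h0, mon_zero, one_mul] at h
  · rw [monIdeal, Ideal.span_le]
    rintro _ ⟨a, ha, rfl⟩
    exact mon_mem_span_pow (ha S.1 S.2)

theorem starIdeal_eq (hcs : c < s) (hreg : RegularUpTo F c) :
    starIdeal c F = monIdeal F (symExp s c 1) := by
  rw [← iInf_span_pow_eq hcs le_rfl hreg]
  simp [starIdeal]

theorem mon_indExp_compl_mul_mem {S : Finset (Fin s)} (hS : S.card = c) {j : Fin s} (hj : j ∈ S) :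
    mon F (indExp Sᶜ 1) * F j ∈ monIdeal F (symExp s c 1) := by
  have : mon F (indExp Sᶜ 1) * F j = mon F (indExp Sᶜ 1 + Pi.single j 1) := by
    rw [mon_add, mon_single, pow_one]
  rw [this]
  refine mon_mem_monIdeal (fun S' hS' => ?_) le_rfl
  by_cases h : S = S'
  · subst h
    refine le_trans ?_ (Finset.single_le_sum (fun i _ => Nat.zero_le _) hj)
    simp
  · obtain ⟨l, hl, hlS⟩ := exists_mem_notMem_of_card_eq (hS.trans hS'.symm) h
    refine le_trans ?_ (Finset.single_le_sum (fun i _ => Nat.zero_le _) hl)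
    simp [indExp, hlS]

theorem span_mon_mul_span_le {S : Finset (Fin s)} (hS : S.card = c) :
    Ideal.span {mon F (indExp Sᶜ 1)} * Ideal.span (F '' (S : Set (Fin s))) ≤
      monIdeal F (symExp s c 1) := by
  rw [Ideal.span_mul_span, Ideal.span_le]
  rintro _ ⟨_, rfl, _, ⟨j, hj, rfl⟩, rfl⟩
  exact mon_indExp_compl_mul_mem hS hj

theorem exists_mem_of_mon_indExp_mem {P : Ideal R} [P.IsPrime] {T : Finset (Fin s)}
    (h : mon F (indExp T 1) ∈ P) : ∃ j ∈ T, F j ∈ P := by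
  rw [mon, Ideal.IsPrime.prod_mem_iff] at h
  obtain ⟨j, -, hj⟩ := h
  by_cases hjT : j ∈ T
  · exact ⟨j, hjT, by simpa [indExp, hjT] using hj⟩
  · simp only [indExp, if_neg hjT, pow_zero] at hj
    exact absurd ((Ideal.eq_top_iff_one P).2 hj) (Ideal.IsPrime.ne_top ‹_›)

theorem mem_colon_singleton_mk {I : Ideal R} {x h : R} :
    x ∈ (⊥ : Submodule R (R ⧸ I)).colon {Ideal.Quotient.mk I h} ↔ x * h ∈ I := by
  rw [Submodule.mem_colon_singleton, Submodule.mem_bot, ← Ideal.Quotient.eq_zero_iff_mem]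
  rfl

/-- Multiplication by the product of the forms outside `S` embeds `R/(F_S)` into `R/I_c`, since that
product is regular modulo `(F_S)`. -/
theorem isAssociatedPrime_starIdeal (hcs : c < s) (hreg : RegularUpTo F c) {S : Finset (Fin s)}
    (hS : S.card = c) {P : Ideal R}
    (hP : IsAssociatedPrime P (R ⧸ Ideal.span (F '' (S : Set (Fin s))))) :
    IsAssociatedPrime P (R ⧸ starIdeal c F) := by
  set u := mon F (indExp Sᶜ 1) with hu
  have hle : Ideal.span (F '' (S : Set (Fin s))) ≤
      Submodule.comap (LinearMap.mulLeft R u) (starIdeal c F) := by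
    rw [starIdeal_eq hcs hreg, Ideal.span_le]
    rintro _ ⟨j, hj, rfl⟩
    exact mon_indExp_compl_mul_mem hS hj
  refine hP.map_of_injective (Submodule.mapQ (Ideal.span (F '' (S : Set (Fin s)))) (starIdeal c F)
    (LinearMap.mulLeft R u) hle) ?_
  rw [← LinearMap.ker_eq_bot, LinearMap.ker_eq_bot']
  intro x hx
  obtain ⟨y, rfl⟩ := Ideal.Quotient.mk_surjective x
  have h1 : Ideal.Quotient.mk (starIdeal c F) (u * y) = 0 := hx
  rw [Ideal.Quotient.eq_zero_iff_mem] at h1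
  have h2 : u * y ∈ Ideal.span (F '' (S : Set (Fin s))) := by
    have : starIdeal c F ≤ Ideal.span (F '' (S : Set (Fin s))) :=
      iInf_le (fun S : {S : Finset (Fin s) // S.card = c} =>
        Ideal.span (F '' (S.1 : Set (Fin s)))) ⟨S, hS⟩
    exact this h1
  rw [Ideal.Quotient.eq_zero_iff_mem, ← powIdeal_one (n := 1) fun _ _ => rfl]
  refine hreg.mem_powIdeal_of_mon_mul_mem hS.le (a := indExp Sᶜ 1) ?_
  rwa [powIdeal_one]
  intro i hi
  simp [indExp, hi]

theorem exists_lt_of_mem_degExp {S : Finset (Fin s)} {e e' : ℕ} {a b : Fin s → ℕ}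
    (ha : a ∈ degExp S e) (hb : b ∈ degExp S e') (hee : e ≤ e') (hne : b ≠ a) :
    ∃ i ∈ S, a i < b i := by
  by_contra hcon
  push Not at hcon
  rw [mem_degExp] at ha hb
  have hle : ∀ i ∈ Finset.univ, b i ≤ a i := by
    intro i _
    by_cases hi : i ∈ S
    · exact hcon i hi
    · rw [hb.1 i hi]; exact Nat.zero_le _
  have := Finset.sum_le_sum hle
  refine hne (funext fun i => (Finset.sum_eq_sum_iff_of_le hle).1 (by omega) i (Finset.mem_univ i))

variable [IsNoetherianRing R]

/-- An associated prime of the star configuration contains exactly `c` of the elements. -/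
theorem exists_eq_of_isAssociatedPrime (hcs : c < s) (hreg : RegularUpTo F c) {P : Ideal R}
    (hP : IsAssociatedPrime P (R ⧸ starIdeal c F)) :
    ∃ S : Finset (Fin s), S.card = c ∧ mon F (indExp Sᶜ 1) ∉ P := by
  classical
  rw [starIdeal_eq hcs hreg] at hP
  obtain ⟨hprime, x, hx⟩ := isAssociatedPrime_iff.1 hP
  obtain ⟨h, rfl⟩ := Ideal.Quotient.mk_surjective x
  have hmem : ∀ y, y ∈ P ↔ y * h ∈ monIdeal F (symExp s c 1) := fun y => by
    rw [hx, mem_colon_singleton_mk]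
  set V : Finset (Fin s) := Finset.univ.filter fun j => F j ∈ P with hV
  have hVP : mon F (indExp Vᶜ 1) ∉ P := fun h => by
    obtain ⟨j, hj, hjP⟩ := exists_mem_of_mon_indExp_mem h
    simp [hV] at hj
    exact hj hjP
  refine ⟨V, le_antisymm ?_ ?_, hVP⟩
  -- Were `c + 1` of the forms in `P`, the depth statement would put the element `h` annihilated by
  -- `P` into the ideal.
  · by_contra hlt
    obtain ⟨U, hUV, hU⟩ := Finset.exists_subset_card_eq (s := V) (n := c + 1) (by omega)
    have hh : h ∈ monIdeal F (symExp s c 1) :=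
      mem_monIdeal_of_pow_mul_mem hcs le_rfl hreg hU (e := 1) fun j hj => by
        rw [pow_one, ← hmem]
        have := hUV hj
        simp [hV] at this
        exact this
    refine hprime.ne_top ((Ideal.eq_top_iff_one P).2 ?_)
    rwa [hmem, one_mul]
  -- Were there fewer than `c`, every `c`-set would meet `Vᶜ`, so the product of the forms outside
  -- `V` would lie in the ideal and hence in `P`.
  · by_contra hlt
    refine hVP ((hmem _).2 (Ideal.mul_mem_right _ _ (mon_mem_monIdeal (fun S hS => ?_) le_rfl)))
    obtain ⟨j, hj, hjV⟩ := Finset.exists_mem_notMem_of_card_lt_card (s := V) (t := S) (by omega)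
    refine le_trans ?_ (Finset.single_le_sum (fun i _ => Nat.zero_le _) hj)
    simp [indExp, hjV]

/-- The symbolic powers of the star configuration are generated by monomials. -/
theorem symbolicPower_starIdeal (hcs : c < s) (hm : 1 ≤ m) (hreg : RegularUpTo F c) :
    symbolicPower (starIdeal c F) m = monIdeal F (symExp s c m) := by
  classical
  have hmem : ∀ g, g ∈ symbolicPower (starIdeal c F) m ↔
      ∀ P : Ideal R, P ∈ associatedPrimes R (R ⧸ starIdeal c F) →
        ∃ u, u ∉ P ∧ u * g ∈ starIdeal c F ^ m := by
    intro g
    rw [symbolicPower, Submodule.mem_iInf, Subtype.forall]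
    refine forall_congr' fun P => forall_congr' fun hP => ?_
    have : P.IsPrime := hP.isPrime
    rw [Ideal.mem_comap, IsLocalization.algebraMap_mem_map_algebraMap_iff P.primeCompl]
    rfl
  rw [← iInf_span_pow_eq hcs hm hreg]
  ext g
  rw [hmem, Submodule.mem_iInf, Subtype.forall]
  constructor
  · intro hg S hS
    set IS := Ideal.span (F '' (S : Set (Fin s))) with hIS
    have hle : starIdeal c F ≤ IS :=
      iInf_le (fun S : {S : Finset (Fin s) // S.card = c} =>
        Ideal.span (F '' (S.1 : Set (Fin s)))) ⟨S, hS⟩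
    -- The exponent is raised step by step: when `g` is written in monomials of degree `e`, all
    -- coefficients turn out to lie in `IS`. A coefficient outside would have its annihilator modulo
    -- `IS` inside an associated prime `P`, while the multiplier `w ∉ P` of `g` annihilates it.
    suffices h : ∀ e ≤ m, g ∈ IS ^ e from h m le_rfl
    intro e
    induction e with
    | zero => intro _; simp
    | succ e ih =>
      intro he
      obtain ⟨f, hf⟩ := (Submodule.mem_span_image_finset_iff_exists_fun R).1
        (span_pow_le_monIdeal S e (ih (by omega)))
      simp only [smul_eq_mul] at hf
      suffices h : ∀ a, f a ∈ IS by
        rw [← hf, pow_succ']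
        exact Ideal.sum_mem _ fun a _ => Ideal.mul_mem_mul (h a)
          (mon_mem_span_pow (sum_eq_of_mem_degExp a.2).ge)
      intro a
      by_contra ha
      obtain ⟨P, hP, hPle⟩ := exists_le_isAssociatedPrime_of_isNoetherianRing R
        (Ideal.Quotient.mk IS (f a)) (by rwa [Ne, Ideal.Quotient.eq_zero_iff_mem])
      obtain ⟨w, hw, hwg⟩ := hg P (isAssociatedPrime_starIdeal hcs hreg hS hP)
      refine hw (hPle (mem_colon_singleton_mk.2 ?_))
      have h1 : w * g ∈ monIdeal F (degExp S (e + 1) : Set _) :=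
        span_pow_le_monIdeal S _ (Ideal.pow_le_pow_right he (Ideal.pow_right_mono hle m hwg))
      set E : Set (Fin s → ℕ) := (degExp S (e + 1) : Set _) ∪ ((degExp S e).erase a.1 : Set _)
      have hmono : monIdeal F (degExp S (e + 1) : Set _) ≤ monIdeal F E :=
        Ideal.span_mono (Set.image_mono Set.subset_union_left)
      refine hreg.mem_span_of_mon_mul_mem (E := E) (a := a.1) hS.le ?_ ?_
      · rintro b (hb | hb)
        · refine exists_lt_of_mem_degExp a.2 hb (by omega) ?_
          rintro rfl
          have h2 := sum_eq_of_mem_degExp a.2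
          have h3 := sum_eq_of_mem_degExp hb
          omega
        · rw [Finset.mem_coe, Finset.mem_erase] at hb
          exact exists_lt_of_mem_degExp a.2 hb.2 le_rfl hb.1
      · have h2 : mon F a.1 * (w * f a) =
            w * g - ∑ b ∈ Finset.univ.erase a, w * (f b * mon F b.1) := by
          rw [← Finset.mul_sum, ← mul_sub, ← hf,
            ← Finset.add_sum_erase _ _ (Finset.mem_univ a)]
          ring
        rw [h2]
        refine Ideal.sub_mem _ (hmono h1) (Ideal.sum_mem _ fun b hb => ?_)
        refine Ideal.mul_mem_left _ _ (Ideal.mul_mem_left _ _ (mon_mem_monIdeal ?_ le_rfl))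
        right
        rw [Finset.mem_coe, Finset.mem_erase]
        exact ⟨fun h => Finset.ne_of_mem_erase hb (Subtype.ext h), b.2⟩
  · intro hg P hP
    obtain ⟨S, hS, hu⟩ := exists_eq_of_isAssociatedPrime hcs hreg hP
    have hprime : P.IsPrime := hP.isPrime
    -- The product of the forms outside `S` multiplies `(F_S)` into `I_c`, so its `m`-th power
    -- multiplies `(F_S)^m` into `I_c^m`.
    refine ⟨mon F (indExp Sᶜ 1) ^ m, fun h => hu (hprime.mem_of_pow_mem m h), ?_⟩
    have h1 := Ideal.pow_right_mono (span_mon_mul_span_le (F := F) hS) m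
    rw [mul_pow] at h1
    rw [starIdeal_eq hcs hreg]
    exact h1 (Ideal.mul_mem_mul (Ideal.pow_mem_pow (Ideal.mem_span_singleton_self _) m) (hg S hS))

end SymbolicPower

end StarConfiguration

namespace StarConfiguration

/-! ### Counting exponent vectors by level sets. -/

section Counting

variable {s : ℕ}

/-- There are `j` gaps above `min B` exactly when `M + j` elements of `A` exceed it; the remaining
`M` elements of `B` are chosen among those. The induction removes the least element of `A`. -/
theorem sum_powersetCard_gaps (A : Finset (Fin s)) (M : ℕ) (g : ℕ → ℕ) :
    ∑ B ∈ A.powersetCard (M + 1), g ((A \ B).filter fun i => ∃ j, j < i ∧ j ∈ B).card =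
      ∑ j ∈ Finset.range (A.card - M), (M + j).choose j * g j := by
  induction A using Finset.induction_on_min with
  | empty => simp
  | insert a A hmin ih =>
    have ha : a ∉ A := fun h => lt_irrefl _ (hmin a h)
    rw [Finset.powersetCard_succ_insert ha, Finset.sum_union, Finset.sum_image,
      Finset.card_insert_of_notMem ha]
    · have h1 : ∀ B ∈ A.powersetCard (M + 1),
          ((insert a A \ B).filter fun i => ∃ j, j < i ∧ j ∈ B) =
            (A \ B).filter fun i => ∃ j, j < i ∧ j ∈ B := by
        intro B hB
        have hBA := (Finset.mem_powersetCard.1 hB).1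
        ext i
        simp only [Finset.mem_filter, Finset.mem_sdiff, Finset.mem_insert]
        refine ⟨?_, fun ⟨⟨h1, h2⟩, h3⟩ => ⟨⟨Or.inr h1, h2⟩, h3⟩⟩
        rintro ⟨⟨rfl | h1, h2⟩, j, hj, hjB⟩
        · exact absurd (hmin j (hBA hjB)) hj.not_gt
        · exact ⟨⟨h1, h2⟩, j, hj, hjB⟩
      have h2 : ∀ B ∈ A.powersetCard M,
          ((insert a A \ insert a B).filter fun i => ∃ j, j < i ∧ j ∈ insert a B).card =
            A.card - M := by
        intro B hB
        obtain ⟨hBA, hBc⟩ := Finset.mem_powersetCard.1 hB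
        have : ((insert a A \ insert a B).filter fun i => ∃ j, j < i ∧ j ∈ insert a B) =
            A \ B := by
          ext i
          simp only [Finset.mem_filter, Finset.mem_sdiff, Finset.mem_insert, not_or]
          constructor
          · rintro ⟨⟨rfl | h1, h2, h3⟩, -⟩
            · exact absurd rfl h2
            · exact ⟨h1, h3⟩
          · rintro ⟨h1, h2⟩
            exact ⟨⟨Or.inr h1, (hmin i h1).ne', h2⟩, a, hmin i h1, Or.inl rfl⟩
        rw [this, Finset.card_sdiff_of_subset hBA, hBc]
      rw [Finset.sum_congr rfl fun B hB => congrArg (fun X => g X.card) (h1 B hB), ih,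
        Finset.sum_congr rfl fun B hB => congrArg g (h2 B hB), Finset.sum_const,
        Finset.card_powersetCard, smul_eq_mul]
      rcases le_or_gt M A.card with h | h
      · rw [show A.card + 1 - M = (A.card - M) + 1 by omega, Finset.sum_range_succ,
          show M + (A.card - M) = A.card by omega, Nat.choose_symm h]
      · rw [Nat.choose_eq_zero_of_lt h, show A.card + 1 - M = 0 by omega,
          show A.card - M = 0 by omega]
        simp
    · intro B hB Bset hBset h
      have h1 : a ∉ B := fun h => ha ((Finset.mem_powersetCard.1 hB).1 h)
      have h2 : a ∉ Bset := fun h => ha ((Finset.mem_powersetCard.1 hBset).1 h)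
      rw [← Finset.erase_insert h1, ← Finset.erase_insert h2, h]
    · rw [Finset.disjoint_left]
      intro B hB hBset
      obtain ⟨Bset, -, rfl⟩ := Finset.mem_image.1 hBset
      exact ha ((Finset.mem_powersetCard.1 hB).1 (Finset.mem_insert_self a Bset))

/-- The level sets `{i | h ≤ a i}`, `h = 1, 2, …`, have the cardinalities `N + d_h`. -/
def HasType (N : ℕ) : List ℕ → (Fin s → ℕ) → Prop
  | [], a => a = 0
  | x :: d, a => (Finset.univ.filter fun i => 1 ≤ a i).card = N + x ∧
      HasType N d fun i => a i - 1

theorem HasType.le_length {N : ℕ} {d : List ℕ} {a : Fin s → ℕ} (h : HasType N d a) (i : Fin s) :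
    a i ≤ d.length := by
  induction d generalizing a with
  | nil => rw [h]; simp
  | cons x d ih =>
    have := ih h.2
    simp only [List.length_cons]
    omega

theorem HasType.sum_eq {N : ℕ} {d : List ℕ} {a : Fin s → ℕ} (h : HasType N d a) :
    ∑ i, a i = d.sum + d.length * N := by
  induction d generalizing a with
  | nil => rw [h]; simp
  | cons x d ih =>
    have h1 := ih h.2
    have h2 := h.1
    rw [Finset.card_filter] at h2
    have h3 : ∑ i, a i = ∑ i, (a i - 1) + ∑ i, if 1 ≤ a i then 1 else 0 := by
      rw [← Finset.sum_add_distrib]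
      refine Finset.sum_congr rfl fun i _ => ?_
      split_ifs <;> omega
    rw [h3, h1, h2, List.sum_cons, List.length_cons]
    ring

theorem HasType.unique {N : ℕ} (hN : 0 < N) {d d' : List ℕ} {a : Fin s → ℕ}
    (h : HasType N d a) (h' : HasType N d' a) : d = d' := by
  induction d generalizing a d' with
  | nil =>
    cases d' with
    | nil => rfl
    | cons y d' =>
      have h1 := h'.1
      rw [show a = 0 from h] at h1
      simp at h1
      omega
  | cons x d ih =>
    cases d' with
    | nil =>
      have h1 := h.1
      rw [show a = 0 from h'] at h1
      simp at h1
      omega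
    | cons y d' =>
      rw [ih h.2 h'.2, Nat.add_left_cancel (h.1.symm.trans h'.1)]

theorem HasType.card_filter_eq_length {N : ℕ} {d : List ℕ} {a : Fin s → ℕ} (h : HasType N d a)
    (hd : d ≠ []) : (Finset.univ.filter fun i => a i = d.length).card = N + d.getLast hd := by
  induction d generalizing a with
  | nil => exact absurd rfl hd
  | cons x d ih =>
    cases d with
    | nil =>
      rw [List.getLast_singleton, ← h.1]
      congr 1
      ext i
      have := h.le_length i
      simp at this ⊢
      omega
    | cons y d =>
      rw [List.getLast_cons (List.cons_ne_nil y d), ← ih h.2 (List.cons_ne_nil y d)]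
      congr 1
      ext i
      simp only [Finset.mem_filter, Finset.mem_univ, true_and, List.length_cons]
      omega

theorem hasType_map_range {N : ℕ} (t : ℕ) (e : ℕ → ℕ) {a : Fin s → ℕ} (hle : ∀ i, a i ≤ t)
    (h : ∀ j < t, (Finset.univ.filter fun i => j + 1 ≤ a i).card = N + e j) :
    HasType N ((List.range t).map e) a := by
  induction t generalizing a e with
  | zero =>
    funext i
    simpa using hle i
  | succ t ih =>
    rw [List.range_succ_eq_map, List.map_cons, List.map_map]
    refine ⟨by simpa using h 0 (by omega), ih (e ∘ Nat.succ) (fun i => ?_) fun j hj => ?_⟩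
    · have := hle i
      omega
    · rw [Function.comp_apply, ← h (j + 1) (by omega)]
      congr 1
      ext i
      simp only [Finset.mem_filter, Finset.mem_univ, true_and]
      omega

/-- The exponent vectors of type `d` supported on `A`. -/
noncomputable def typeSet (N : ℕ) (A : Finset (Fin s)) (d : List ℕ) : Finset (Fin s → ℕ) := by
  classical
  exact (Fintype.piFinset fun _ => Finset.range (d.length + 1)).filter fun a =>
    (∀ i, i ∉ A → a i = 0) ∧ HasType N d a

theorem mem_typeSet {N : ℕ} {A : Finset (Fin s)} {d : List ℕ} {a : Fin s → ℕ} :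
    a ∈ typeSet N A d ↔ (∀ i, i ∉ A → a i = 0) ∧ HasType N d a := by
  classical
  simp only [typeSet, Finset.mem_filter, Fintype.mem_piFinset, Finset.mem_range,
    and_iff_right_iff_imp]
  rintro ⟨-, h⟩ i
  have := h.le_length i
  omega

/-- Adding the indicator function of `B` to an exponent vector supported on `B`. -/
def raise (B : Finset (Fin s)) (a : Fin s → ℕ) : Fin s → ℕ :=
  fun i => if i ∈ B then a i + 1 else 0

theorem filter_one_le_raise (B : Finset (Fin s)) (a : Fin s → ℕ) :
    (Finset.univ.filter fun i => 1 ≤ raise B a i) = B := by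
  ext i
  rw [Finset.mem_filter]
  by_cases h : i ∈ B <;> simp [raise, h]

theorem raise_sub_one {B : Finset (Fin s)} {a : Fin s → ℕ} (ha : ∀ i, i ∉ B → a i = 0) :
    (fun i => raise B a i - 1) = a := by
  funext i
  by_cases h : i ∈ B
  · simp [raise, h]
  · simp [raise, h, ha i h]

theorem raise_filter_one_le (a : Fin s → ℕ) :
    raise (Finset.univ.filter fun i => 1 ≤ a i) (fun i => a i - 1) = a := by
  funext i
  by_cases h : 1 ≤ a i
  · rw [raise, if_pos (by simpa using h)]; omega
  · rw [raise, if_neg (by simpa using h)]; omega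

theorem sum_typeSet_cons {N : ℕ} (A : Finset (Fin s)) (x : ℕ) (d : List ℕ)
    (f : (Fin s → ℕ) → ℕ) :
    ∑ a ∈ typeSet N A (x :: d), f a =
      ∑ B ∈ A.powersetCard (N + x), ∑ a ∈ typeSet N B d, f (raise B a) := by
  rw [Finset.sum_sigma']
  refine Finset.sum_nbij' (fun a => ⟨Finset.univ.filter fun i => 1 ≤ a i, fun i => a i - 1⟩)
    (fun y => raise y.1 y.2) ?_ ?_ ?_ ?_ ?_
  · intro a ha
    rw [mem_typeSet] at ha
    rw [Finset.mem_sigma, Finset.mem_powersetCard, mem_typeSet]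
    refine ⟨⟨fun i hi => ?_, ha.2.1⟩, fun i hi => ?_, ha.2.2⟩
    · by_contra h
      have := ha.1 i h
      simp [this] at hi
    · simp at hi ⊢
      omega
  · rintro ⟨B, a⟩ hy
    rw [Finset.mem_sigma, Finset.mem_powersetCard, mem_typeSet] at hy
    obtain ⟨⟨hBA, hB⟩, ha, hT⟩ := hy
    dsimp only at *
    rw [mem_typeSet]
    refine ⟨fun i hi => if_neg fun h => hi (hBA h), ?_, ?_⟩
    · rw [filter_one_le_raise, hB]
    · rwa [raise_sub_one ha]
  · intro a _
    exact raise_filter_one_le a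
  · rintro ⟨B, a⟩ hy
    rw [Finset.mem_sigma, Finset.mem_powersetCard, mem_typeSet] at hy
    dsimp only at hy ⊢
    rw [filter_one_le_raise, raise_sub_one hy.2.1]
  · intro a _
    dsimp only
    rw [raise_filter_one_le]

/-- The set `linSet` relative to an ambient set `A` of positions and a largest value `t`. -/
def linSetIn (t : ℕ) (A : Finset (Fin s)) (a : Fin s → ℕ) : Finset (Fin s) :=
  Finset.univ.filter fun i =>
    i ∉ A ∨ a i + 2 ≤ t ∨ (a i + 1 = t ∧ ∃ j, j < i ∧ a j = t)

theorem linSet_eq_linSetIn (a : Fin s → ℕ) : linSet a = linSetIn (topExp a) Finset.univ a := by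
  simp [linSet, linSetIn]

/-- Peeling off the lowest level set: positions of `A` outside `B` have exponent zero, at least two
below `t + 1`, so they are counted on both sides. -/
theorem linSetIn_raise {t : ℕ} (ht : 1 ≤ t) {A B : Finset (Fin s)} (hBA : B ⊆ A)
    {a : Fin s → ℕ} (ha : ∀ i, i ∉ B → a i = 0) :
    linSetIn (t + 1) A (raise B a) = linSetIn t B a := by
  ext i
  simp only [linSetIn, Finset.mem_filter, Finset.mem_univ, true_and]
  have hj : ∀ j, raise B a j = t + 1 ↔ a j = t := by
    intro j
    by_cases h : j ∈ B
    · simp [raise, h]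
    · simp [raise, h, ha j h]; omega
  simp only [hj]
  by_cases h : i ∈ B
  · have h1 : raise B a i = a i + 1 := if_pos h
    have h2 := hBA h
    rw [h1]
    simp only [h, h2, not_true, false_or]
    rw [show a i + 1 + 2 ≤ t + 1 ↔ a i + 2 ≤ t by omega,
      show a i + 1 + 1 = t + 1 ↔ a i + 1 = t by omega]
  · have h1 : raise B a i = 0 := if_neg h
    rw [h1]
    simp only [h, not_false_eq_true, true_or, iff_true]
    right; left; omega

theorem card_linSetIn_raise_zero (A B : Finset (Fin s)) :
    (linSetIn 1 A (raise B 0)).card =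
      s - A.card + ((A \ B).filter fun i => ∃ j, j < i ∧ j ∈ B).card := by
  have h : linSetIn 1 A (raise B 0) = Aᶜ ∪ (A \ B).filter fun i => ∃ j, j < i ∧ j ∈ B := by
    ext i
    have hj : ∀ j, raise B 0 j = 1 ↔ j ∈ B := by
      intro j
      by_cases h : j ∈ B <;> simp [raise, h]
    simp only [linSetIn, Finset.mem_filter, Finset.mem_univ, true_and, hj, Finset.mem_union,
      Finset.mem_compl, Finset.mem_sdiff]
    by_cases hA : i ∈ A
    · by_cases hB : i ∈ B
      · simp [hA, hB, raise]
      · simp [hA, hB, raise]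
    · simp [hA]
  rw [h, Finset.card_union_of_disjoint, Finset.card_compl, Fintype.card_fin]
  rw [Finset.disjoint_left]
  intro i hi hi'
  simp at hi hi'
  exact hi hi'.1.1

theorem typeSet_nil {N : ℕ} (A : Finset (Fin s)) : typeSet N A [] = {0} := by
  ext a
  rw [mem_typeSet, Finset.mem_singleton]
  exact ⟨fun h => h.2, fun h => ⟨fun i _ => by rw [h]; rfl, h⟩⟩

theorem entry_cons_succ (y x : ℕ) (d : List ℕ) (h : ℕ) :
    entry y (x :: d) (h + 1) = entry x d h := rfl

/-- The weighted number of exponent vectors of a given type. -/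
theorem sum_typeSet_choose {N c k : ℕ} (hN : 0 < N) (hs : s = N + c) (d : List ℕ) (hd : d ≠ [])
    (y : ℕ) (hy : y ≤ c) (hsort : (y :: d).Pairwise (· ≥ ·)) (A : Finset (Fin s))
    (hA : A.card = N + y) :
    ∑ a ∈ typeSet N A d, (linSetIn d.length A a).card.choose k =
      (∏ h ∈ Finset.range (d.length - 1),
        (N + entry y d h).choose (N + entry y d (h + 1))) *
      ∑ j ∈ Finset.range (entry y d (d.length - 1) - entry y d d.length + 1),
        (c - entry y d (d.length - 1) + j).choose k *
          (N + entry y d d.length + j - 1).choose j := by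
  induction d generalizing y A with
  | nil => exact absurd rfl hd
  | cons x d ih =>
    have hxy : x ≤ y := (List.pairwise_cons.1 hsort).1 x (by simp)
    rw [sum_typeSet_cons]
    -- Only the choice of the last level set affects the size of `linSetIn`, through the gaps above
    -- its minimum. Each earlier choice contributes a plain binomial factor.
    cases d with
    | nil =>
      have h1 : ∀ B ∈ A.powersetCard (N + x), ∑ a ∈ typeSet N B [],
          (linSetIn [x].length A (raise B a)).card.choose k =
          (s - A.card + ((A \ B).filter fun i => ∃ j, j < i ∧ j ∈ B).card).choose k := by
        intro B _
        rw [typeSet_nil, Finset.sum_singleton, List.length_singleton,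
          card_linSetIn_raise_zero]
      rw [Finset.sum_congr rfl h1]
      obtain ⟨M, hM⟩ : ∃ M, N + x = M + 1 := ⟨N + x - 1, by omega⟩
      rw [hM, sum_powersetCard_gaps A M fun j => (s - A.card + j).choose k]
      simp only [List.length_singleton, Nat.sub_self, Finset.range_zero, Finset.prod_empty,
        one_mul]
      have e0 : entry y [x] 0 = y := rfl
      have e1 : entry y [x] 1 = x := rfl
      rw [e0, e1, show A.card - M = y - x + 1 by omega]
      refine Finset.sum_congr rfl fun j _ => ?_
      rw [mul_comm, show s - A.card = c - y by omega, show N + x + j - 1 = M + j by omega]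
    | cons z d =>
      have hne : z :: d ≠ [] := List.cons_ne_nil z d
      have hsort' := (List.pairwise_cons.1 hsort).2
      have h1 : ∀ B ∈ A.powersetCard (N + x), ∑ a ∈ typeSet N B (z :: d),
          (linSetIn (x :: z :: d).length A (raise B a)).card.choose k =
          (∏ h ∈ Finset.range ((z :: d).length - 1),
            (N + entry x (z :: d) h).choose (N + entry x (z :: d) (h + 1))) *
          ∑ j ∈ Finset.range (entry x (z :: d) ((z :: d).length - 1) -
              entry x (z :: d) (z :: d).length + 1),
            (c - entry x (z :: d) ((z :: d).length - 1) + j).choose k *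
              (N + entry x (z :: d) (z :: d).length + j - 1).choose j := by
        intro B hB
        obtain ⟨hBA, hBc⟩ := Finset.mem_powersetCard.1 hB
        rw [← ih hne x (hxy.trans hy) hsort' B hBc]
        refine Finset.sum_congr rfl fun a ha => ?_
        rw [List.length_cons, linSetIn_raise (by simp) hBA (mem_typeSet.1 ha).1]
      rw [Finset.sum_congr rfl h1, Finset.sum_const, Finset.card_powersetCard, smul_eq_mul,
        ← mul_assoc]
      have hlen : (x :: z :: d).length - 1 = ((z :: d).length - 1) + 1 := by simp
      rw [hlen, List.length_cons (a := x), entry_cons_succ, entry_cons_succ,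
        Finset.prod_range_succ', mul_comm ((A.card).choose _)]
      simp only [entry_cons_succ]
      have e0 : entry y (x :: z :: d) 0 = y := rfl
      have e1 : entry x (z :: d) 0 = x := rfl
      rw [e0, e1, hA]

end Counting

end StarConfiguration

namespace StarConfiguration

/-! ### Partitions and the index of overlap. -/

section Partitions

variable {m c : ℕ}

theorem pairwise_entries (p : m.Partition) : (entries p).Pairwise (· ≥ ·) :=
  Multiset.pairwise_sort _ _

theorem coe_entries (p : m.Partition) : (entries p : Multiset ℕ) = p.parts :=
  Multiset.sort_eq _ _

theorem mem_entries {p : m.Partition} {x : ℕ} : x ∈ entries p ↔ x ∈ p.parts := by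
  rw [← coe_entries, Multiset.mem_coe]

theorem sum_entries (p : m.Partition) : (entries p).sum = m := by
  rw [← Multiset.sum_coe, coe_entries, p.parts_sum]

theorem pos_of_mem_entries {p : m.Partition} {x : ℕ} (hx : x ∈ entries p) : 0 < x :=
  p.parts_pos (mem_entries.1 hx)

theorem entries_injective : Function.Injective (entries (m := m)) := by
  intro p q h
  ext1
  rw [← coe_entries, ← coe_entries, h]

theorem mem_partitionsLE {p : m.Partition} : p ∈ partitionsLE c m ↔ ∀ x ∈ entries p, x ≤ c := by
  simp [partitionsLE, mem_entries]

theorem exists_entries_eq {d : List ℕ} (hsort : d.Pairwise (· ≥ ·)) (hpos : ∀ x ∈ d, 0 < x)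
    (hsum : d.sum = m) : ∃ p : m.Partition, entries p = d := by
  refine ⟨⟨d, fun hx => hpos _ hx, by simpa using hsum⟩, ?_⟩
  refine List.Perm.eq_of_pairwise (le := (· ≥ ·)) (fun a b _ _ h1 h2 => le_antisymm h2 h1)
    (pairwise_entries _) hsort ?_
  rw [← Multiset.coe_eq_coe, coe_entries]

theorem entry_zero (d : List ℕ) : entry c d 0 = c := rfl

theorem entry_succ (d : List ℕ) (h : ℕ) : entry c d (h + 1) = d.getD h 0 := rfl

theorem entry_append {l : List ℕ} (l' : List ℕ) {h : ℕ} (hh : h ≤ l.length) :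
    entry c (l ++ l') h = entry c l h := by
  rw [entry, entry, ← List.cons_append, List.getD_append _ _ _ _ (by simp; omega)]

theorem entry_antitone {d : List ℕ} (hsort : (c :: d).Pairwise (· ≥ ·)) : Antitone (entry c d) := by
  intro h h' hh
  rcases hh.eq_or_lt with rfl | hlt
  · exact le_rfl
  by_cases hl : h' < (c :: d).length
  · have := List.pairwise_iff_getElem.1 hsort h h' (by omega) hl hlt
    simpa only [entry, List.getD_eq_getElem _ _ hl,
      List.getD_eq_getElem _ _ (show h < (c :: d).length by omega)] using this
  · rw [entry, entry, List.getD_eq_default _ _ (by omega)]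
    exact Nat.zero_le _

theorem pairwise_cons_entries {p : m.Partition} (hp : p ∈ partitionsLE c m) :
    (c :: entries p).Pairwise (· ≥ ·) :=
  List.pairwise_cons.2 ⟨mem_partitionsLE.1 hp, pairwise_entries p⟩

theorem sum_eq_sum_getD {d : List ℕ} {t : ℕ} (ht : d.length ≤ t) :
    d.sum = ∑ h ∈ Finset.range t, d.getD h 0 := by
  induction d generalizing t with
  | nil => simp
  | cons x d ih =>
    obtain ⟨t, rfl⟩ : ∃ t', t = t' + 1 := ⟨t - 1, by simp at ht; omega⟩
    rw [Finset.sum_range_succ', List.sum_cons, ih (t := t) (by simpa using ht), add_comm]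
    simp

theorem length_pos_entries (hm : 0 < m) (p : m.Partition) : 0 < (entries p).length := by
  rw [List.length_pos_iff]
  intro h
  have := sum_entries p
  rw [h] at this
  simp at this
  omega

theorem entry_length_pos (hm : 0 < m) (p : m.Partition) :
    0 < entry c (entries p) (entries p).length := by
  have h := length_pos_entries hm p
  obtain ⟨t, ht⟩ : ∃ t, (entries p).length = t + 1 := ⟨(entries p).length - 1, by omega⟩
  rw [ht, entry_succ, List.getD_eq_getElem _ _ (by omega)]
  exact pos_of_mem_entries (List.getElem_mem _)

theorem lex_irrefl (d : List ℕ) : ¬ List.Lex (· < ·) d d := by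
  induction d with
  | nil => intro h; cases h
  | cons x d ih =>
    intro h
    cases h with
    | cons h => exact ih h
    | rel h => exact lt_irrefl _ h

theorem lex_append_left (l a b : List ℕ) (h : List.Lex (· < ·) a b) :
    List.Lex (· < ·) (l ++ a) (l ++ b) := by
  induction l with
  | nil => exact h
  | cons x l ih => exact List.Lex.cons ih

/-- The indices counted by the overlap index are smaller than the length. -/
theorem lt_length_of_overlap (hm : 0 < m) {p b : m.Partition} {j : ℕ}
    (hgt : AlexGT (entries b) (entries p))
    (hag : ∀ h, 1 ≤ h → h ≤ j - 1 → entry c (entries p) h = entry c (entries b) h) :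
    j < (entries p).length := by
  by_contra hj
  have hlen := length_pos_entries hm p
  have hble : (entries b).length ≤ (entries p).length := by
    rcases hgt with h | h
    · exact h.le
    · exact h.1.le
  obtain ⟨t, ht⟩ : ∃ t, (entries p).length = t + 1 := ⟨(entries p).length - 1, by omega⟩
  have hag' : ∀ h < t, (entries p).getD h 0 = (entries b).getD h 0 := fun h hh => by
    have := hag (h + 1) (by omega) (by omega)
    rwa [entry_succ, entry_succ] at this
  have h1 := sum_eq_sum_getD (d := entries p) (t := t + 1) ht.le
  have h2 := sum_eq_sum_getD (d := entries b) (t := t + 1) (ht ▸ hble)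
  rw [sum_entries, Finset.sum_range_succ] at h1 h2
  rw [Finset.sum_congr rfl fun h hh => hag' h (Finset.mem_range.1 hh)] at h1
  -- All earlier entries agree and both partitions sum to `m`, so position `t` agrees too. As this
  -- entry is positive, the lengths coincide.
  have h3 : (entries p).getD t 0 = (entries b).getD t 0 := by omega
  have h4 : 0 < (entries p).getD t 0 := by
    have := entry_length_pos (c := c) hm p
    rwa [ht, entry_succ] at this
  have h5 : (entries b).length = t + 1 := by
    by_contra hne
    rw [h3, List.getD_eq_default _ _ (by omega)] at h4
    omega
  have h6 : entries b = entries p := by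
    refine List.ext_getElem (by omega) fun i hi hi' => ?_
    rw [← List.getD_eq_getElem _ 0 hi, ← List.getD_eq_getElem _ 0 hi']
    rcases Nat.lt_or_ge i t with h | h
    · exact (hag' i h).symm
    · rw [show i = t by omega]
      exact h3.symm
  rw [h6] at hgt
  rcases hgt with h | h
  · exact lt_irrefl _ h
  · exact lex_irrefl _ h.2

/-- A descent of a partition before its last entry yields a larger partition sharing the entries
before the descent. -/
theorem exists_alexGT_of_descent {p : m.Partition} (hp : p ∈ partitionsLE c m)
    {v : ℕ} (hv : 1 ≤ v) (hvt : v < (entries p).length)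
    (hdesc : entry c (entries p) v < entry c (entries p) (v - 1)) :
    ∃ b ∈ partitionsLE c m, AlexGT (entries b) (entries p) ∧
      ∀ h, 1 ≤ h → h ≤ v - 1 → entry c (entries p) h = entry c (entries b) h := by
  obtain ⟨u, rfl⟩ : ∃ u, v = u + 1 := ⟨v - 1, by omega⟩
  set d := entries p with hd
  have hu : u < d.length := by omega
  obtain ⟨pre, x, mid, z, hdec, hpre⟩ : ∃ pre x mid z, d = pre ++ x :: (mid ++ [z]) ∧
      pre.length = u := by
    have h1 : d = d.take u ++ d[u] :: d.drop (u + 1) := by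
      rw [List.cons_getElem_drop_succ, List.take_append_drop]
    have h2 : d.drop (u + 1) ≠ [] := by
      rw [Ne, List.drop_eq_nil_iff]; omega
    refine ⟨d.take u, d[u], (d.drop (u + 1)).dropLast, (d.drop (u + 1)).getLast h2, ?_, ?_⟩
    · rw [List.dropLast_append_getLast]
      exact h1
    · rw [List.length_take]; omega
  have hsort : (c :: d).Pairwise (· ≥ ·) := pairwise_cons_entries hp
  have hx : entry c d (u + 1) = x := by
    rw [entry_succ, hdec, List.getD_append_right _ _ _ _ hpre.le]
    simp [hpre]
  have hxlt : ∀ y ∈ c :: pre, x + 1 ≤ y := by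
    intro y hy
    obtain ⟨i, hi, rfl⟩ := List.getElem_of_mem hy
    have h1 : (c :: pre)[i] = entry c d i := by
      rw [entry, hdec, ← List.cons_append, List.getD_append _ _ _ _ hi,
        List.getD_eq_getElem _ _ hi]
    rw [h1]
    have h2 : entry c d u ≤ entry c d i := entry_antitone hsort (by
      simp at hi; omega)
    rw [hx] at hdesc
    simp only [Nat.add_sub_cancel] at hdesc
    omega
  have hzpos : 0 < z := pos_of_mem_entries (p := p) (by rw [← hd, hdec]; simp)
  rw [hdec] at hsort
  have hsum : (pre ++ x :: (mid ++ [z])).sum = m := by rw [← hdec]; exact sum_entries p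
  have hposd : ∀ y ∈ pre ++ x :: (mid ++ [z]), 0 < y := fun y hy =>
    pos_of_mem_entries (p := p) (by rw [← hd, hdec]; exact hy)
  have hsort' : (c :: (pre ++ (x + 1) :: (mid ++ [z - 1]))).Pairwise (· ≥ ·) := by
    simp only [List.pairwise_cons, List.pairwise_append, List.mem_append, List.mem_cons,
      List.not_mem_nil] at hsort hxlt ⊢
    grind
  have hag : ∀ tl : List ℕ, ∀ h, 1 ≤ h → h ≤ u + 1 - 1 →
      entry c d h = entry c (pre ++ tl) h := by
    intro tl h h1 h2
    rw [hdec, entry_append _ (by omega), entry_append _ (by omega)]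
  -- The larger partition has the entry `x` at the descent raised by one and the last entry `z`
  -- lowered by one. If `z = 1` the last entry disappears and the partition is shorter; otherwise it
  -- is lexicographically larger.
  by_cases hz : z = 1
  · obtain ⟨b, hb⟩ := exists_entries_eq (m := m) (d := pre ++ (x + 1) :: mid)
      (by
        have := (List.pairwise_cons.1 hsort').2
        rw [show pre ++ (x + 1) :: (mid ++ [z - 1]) = (pre ++ (x + 1) :: mid) ++ [z - 1] by
          simp] at this
        exact (List.pairwise_append.1 this).1)
      (fun y hy => by
        simp only [List.mem_append, List.mem_cons] at hy hposd
        rcases hy with h | rfl | h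
        · exact hposd y (Or.inl h)
        · omega
        · exact hposd y (by simp [h]))
      (by simp at hsum ⊢; omega)
    refine ⟨b, mem_partitionsLE.2 fun y hy => ?_, Or.inl ?_, ?_⟩
    · rw [hb] at hy
      refine (List.pairwise_cons.1 hsort').1 y ?_
      simp only [List.mem_append, List.mem_cons] at hy ⊢
      tauto
    · rw [hb, hdec]; simp
    · rw [hb]
      exact hag _
  · obtain ⟨b, hb⟩ := exists_entries_eq (m := m) (d := pre ++ (x + 1) :: (mid ++ [z - 1]))
      (List.pairwise_cons.1 hsort').2
      (fun y hy => by
        simp only [List.mem_append, List.mem_cons, List.not_mem_nil, or_false] at hy hposd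
        rcases hy with h | rfl | h | rfl
        · exact hposd y (Or.inl h)
        · omega
        · exact hposd y (by simp [h])
        · omega)
      (by simp at hsum ⊢; omega)
    refine ⟨b, mem_partitionsLE.2 fun y hy => ?_, Or.inr ⟨?_, ?_⟩, ?_⟩
    · rw [hb] at hy
      exact (List.pairwise_cons.1 hsort').1 y hy
    · rw [hb, hdec]; simp
    · rw [hb, hdec]
      exact lex_append_left _ _ _ (List.Lex.rel (Nat.lt_succ_self x))
    · rw [hb]
      exact hag _

/-- If the next-to-last entry were `c`, so would be all before it, and uniqueness of `m = q c + r`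
with `1 ≤ r ≤ c` would force the largest partition. The convention `d_0 = c` covers length one. -/
theorem entry_eq_of_nonmaximal {q r : ℕ} (hm : 0 < m) (hqr : m = q * c + r) (hr : 1 ≤ r)
    (hrc : r ≤ c) {p : m.Partition} (hp : p ∈ partitionsLE c m)
    (hne : entries p ≠ List.replicate q c ++ [r]) :
    entry c (entries p) ((entries p).length - 1) < c := by
  have hsort := pairwise_cons_entries hp
  have hanti := entry_antitone hsort
  refine lt_of_le_of_ne (hanti (Nat.zero_le _)) fun h => hne ?_
  have hlen := length_pos_entries hm p
  obtain ⟨t, ht⟩ : ∃ t, (entries p).length = t + 1 := ⟨(entries p).length - 1, by omega⟩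
  set d := entries p with hd
  have hall : ∀ i < t, d.getD i 0 = c := by
    intro i hi
    have h1 : entry c d (d.length - 1) ≤ entry c d (i + 1) := hanti (by omega)
    have h2 : entry c d (i + 1) ≤ c := hanti (Nat.zero_le (i + 1))
    rw [← entry_succ (c := c)]
    omega
  have hlast : d.getD t 0 = entry c d d.length := by rw [ht, entry_succ]
  have hpos := entry_length_pos (c := c) hm p
  have hle : entry c d d.length ≤ c := hanti (Nat.zero_le _)
  have hsum := sum_entries p
  rw [sum_eq_sum_getD (t := t + 1) ht.le, Finset.sum_range_succ,
    Finset.sum_congr rfl fun i hi => hall i (Finset.mem_range.1 hi), Finset.sum_const,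
    Finset.card_range, smul_eq_mul, hlast] at hsum
  rw [← hd] at hpos
  set z := entry c d d.length with hz
  have htq : t = q := by
    rcases lt_trichotomy t q with h | h | h
    · have := Nat.mul_le_mul_right c (Nat.succ_le_of_lt h)
      rw [Nat.succ_mul] at this
      omega
    · exact h
    · have := Nat.mul_le_mul_right c (Nat.succ_le_of_lt h)
      rw [Nat.succ_mul] at this
      omega
  have hzr : z = r := by
    rw [htq] at hsum
    omega
  refine List.ext_getElem (by simp [ht, htq]) fun i hi hi' => ?_
  rw [← List.getD_eq_getElem _ 0 hi, ← List.getD_eq_getElem _ 0 hi']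
  rcases Nat.lt_or_ge i t with h1 | h1
  · rw [hall i h1, List.getD_append _ _ _ _ (by simp; omega),
      List.getD_eq_getElem _ _ (by simp; omega), List.getElem_replicate]
  · rw [show i = t by omega, hlast, hzr, List.getD_append_right _ _ _ _ (by simp; omega)]
    simp [htq]

/-- The index of overlap lies in the last constant run before the final entry. -/
theorem overlapIndex_spec {q r : ℕ} (hm : 0 < m) (hqr : m = q * c + r) (hr : 1 ≤ r)
    (hrc : r ≤ c) {p : m.Partition} (hp : p ∈ partitionsLE c m)
    (hne : entries p ≠ List.replicate q c ++ [r]) :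
    overlapIndex c p ≤ (entries p).length - 1 ∧
      ∀ h, overlapIndex c p ≤ h → h ≤ (entries p).length - 1 →
        entry c (entries p) h = entry c (entries p) ((entries p).length - 1) := by
  have hanti := entry_antitone (pairwise_cons_entries hp)
  have hlt := entry_eq_of_nonmaximal hm hqr hr hrc hp hne
  set T := {j : ℕ | 1 ≤ j ∧ ∃ b ∈ partitionsLE c m, AlexGT (entries b) (entries p) ∧
    ∀ h, 1 ≤ h → h ≤ j - 1 → entry c (entries p) h = entry c (entries b) h} with hT
  have hbdd : ∀ j ∈ T, j ≤ (entries p).length - 1 := by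
    rintro j ⟨-, b, -, hgt, hag⟩
    have := lt_length_of_overlap hm hgt hag
    omega
  -- If `d_h` differs from the next-to-last entry, a descent occurs after `h` and before the last
  -- entry, and every such descent is an index counted in `T`.
  have key : ∀ h ≤ (entries p).length - 1,
      entry c (entries p) h ≠ entry c (entries p) ((entries p).length - 1) →
      ∃ v ∈ T, h < v := by
    intro h hh hne'
    have hgt : entry c (entries p) ((entries p).length - 1) < entry c (entries p) h :=
      lt_of_le_of_ne (hanti hh) hne'.symm
    by_contra hcon
    push Not at hcon
    have hconst : ∀ n, h + n ≤ (entries p).length - 1 →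
        entry c (entries p) (h + n) = entry c (entries p) h := by
      intro n
      induction n with
      | zero => intro _; rfl
      | succ n ih =>
        intro hn
        have h1 := ih (by omega)
        by_contra h2
        have h3 : entry c (entries p) (h + (n + 1)) ≤ entry c (entries p) (h + n) :=
          hanti (by omega)
        have hmem : h + (n + 1) ∈ T := ⟨by omega, exists_alexGT_of_descent hp (by omega)
          (by omega) (by
            rw [show h + (n + 1) - 1 = h + n by omega]
            omega)⟩
        have := hcon _ hmem
        omega
    have := hconst ((entries p).length - 1 - h) (by omega)
    rw [show h + ((entries p).length - 1 - h) = (entries p).length - 1 by omega] at this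
    omega
  have hTne : T.Nonempty := by
    obtain ⟨v, hv, -⟩ := key 0 (Nat.zero_le _) (by rw [entry_zero]; exact hlt.ne')
    exact ⟨v, hv⟩
  have hBdd : BddAbove T := ⟨_, hbdd⟩
  have hle : overlapIndex c p ≤ (entries p).length - 1 := csSup_le hTne hbdd
  refine ⟨hle, fun h h1 h2 => ?_⟩
  by_contra hne'
  obtain ⟨v, hv, hlt'⟩ := key h h2 hne'
  have : v ≤ overlapIndex c p := le_csSup hBdd hv
  omega

end Partitions

end StarConfiguration

namespace StarConfiguration

/-! ### The weighted count in terms of partitions. -/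

section Formula

variable {s c m : ℕ}

/-- Since `C(j, k) C(M + j, j) = C(M + k, k) C(M + j, j - k)`, the constant factor comes out and a
hockey-stick sum remains. -/
theorem sum_choose_mul_choose (M K k : ℕ) :
    ∑ j ∈ Finset.range (K + 1), j.choose k * (M + j).choose j =
      if k ≤ K then (M + K + 1).choose (K - k) * (M + k).choose k else 0 := by
  have hid : ∀ j, k ≤ j →
      j.choose k * (M + j).choose j = (M + k).choose k * (M + j).choose (j - k) := by
    intro j hj
    obtain ⟨l, rfl⟩ : ∃ l, j = k + l := ⟨j - k, by omega⟩
    rw [show k + l - k = l by omega]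
    have h1 := Nat.choose_mul (n := M + (k + l)) (k := k + l) (s := k) (by omega)
    have h2 := Nat.choose_mul (n := M + (k + l)) (k := M + k) (s := k) (by omega)
    have h3 : (M + (k + l)).choose (M + k) = (M + (k + l)).choose l := by
      rw [← Nat.choose_symm (show l ≤ M + (k + l) by omega)]
      congr 1; omega
    have h4 : (M + (k + l) - k).choose (k + l - k) = (M + (k + l) - k).choose (M + k - k) := by
      rw [← Nat.choose_symm (show k + l - k ≤ M + (k + l) - k by omega)]
      congr 1; omega
    rw [h4, ← h2, h3] at h1
    rw [mul_comm, h1, mul_comm]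
  split_ifs with hk
  · induction K, hk using Nat.le_induction with
    | base =>
      rw [Finset.sum_range_succ, Finset.sum_eq_zero, Nat.sub_self, hid k le_rfl]
      · simp
      · intro j hj
        rw [Nat.choose_eq_zero_of_lt (Finset.mem_range.1 hj), zero_mul]
    | succ K hK ih =>
      rw [Finset.sum_range_succ, ih, hid (K + 1) (by omega), mul_comm, ← mul_add, mul_comm]
      congr 1
      rw [show K + 1 - k = (K - k) + 1 by omega, show M + (K + 1) + 1 = (M + K + 1) + 1 by omega,
        Nat.choose_succ_succ, show M + (K + 1) = M + K + 1 by omega]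
  · refine Finset.sum_eq_zero fun j hj => ?_
    rw [Finset.mem_range] at hj
    rw [Nat.choose_eq_zero_of_lt (by omega), zero_mul]

theorem chainProd_eq_prod_range (d : List ℕ) (n : ℕ) :
    chainProd s c d n =
      ∏ h ∈ Finset.range n, (s - c + entry c d h).choose (s - c + entry c d (h + 1)) := by
  rw [chainProd]
  induction n with
  | zero => rfl
  | succ n ih => rw [Finset.prod_range_succ, ← ih, Finset.prod_Icc_succ_top (by omega)]; rfl

theorem topExp_of_hasType {N : ℕ} {a : Fin s → ℕ} {d : List ℕ} (h : HasType N d a) (hd : d ≠ [])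
    (hN : 0 < N) : topExp a = d.length := by
  refine le_antisymm (Finset.sup_le fun i _ => h.le_length i) ?_
  have h1 := h.card_filter_eq_length hd
  have h2 : 0 < (Finset.univ.filter fun i => a i = d.length).card := by omega
  obtain ⟨i, hi⟩ := Finset.card_pos.1 h2
  rw [Finset.mem_filter] at hi
  rw [← hi.2]
  exact le_topExp a i

theorem entries_ne_nil (hm : 0 < m) (p : m.Partition) : entries p ≠ [] :=
  List.length_pos_iff.1 (length_pos_entries hm p)

theorem isGen_of_hasType (hcs : c < s) (hm : 0 < m) {p : m.Partition} {a : Fin s → ℕ}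
    (h : HasType (s - c) (entries p) a) : IsGen c m a := by
  have hd := entries_ne_nil hm p
  have htop := topExp_of_hasType h hd (by omega)
  refine ⟨by rw [h.sum_eq, sum_entries, htop], ?_⟩
  have h1 := h.card_filter_eq_length hd
  rw [topSet, htop, h1]
  have := pos_of_mem_entries (List.getLast_mem hd)
  omega

/-- The partition is read off from the sizes of the level sets. Each contains `topSet a`, so its
size exceeds `s - c` and the entry is positive. -/
theorem IsGen.exists_hasType (hcs : c < s) {a : Fin s → ℕ} (ha : IsGen c m a) :
    ∃ p ∈ partitionsLE c m, HasType (s - c) (entries p) a := by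
  set lev : ℕ → ℕ := fun h => (Finset.univ.filter fun i => h + 1 ≤ a i).card with hlev
  have hlow : ∀ h < topExp a, s - c + 1 ≤ lev h := by
    intro h hh
    refine ha.2.trans (Finset.card_le_card fun i hi => ?_)
    rw [mem_topSet] at hi
    simp
    omega
  have hup : ∀ h, lev h ≤ s := fun h => by
    have := Finset.card_le_univ (Finset.univ.filter fun i => h + 1 ≤ a i)
    rwa [Fintype.card_fin] at this
  set d := (List.range (topExp a)).map fun h => lev h - (s - c) with hd
  have hT : HasType (s - c) d a := hasType_map_range _ _ (le_topExp a) fun h hh => by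
    have := hlow h hh
    change lev h = _
    omega
  have hmem : ∀ x ∈ d, ∃ h < topExp a, x = lev h - (s - c) := by
    intro x hx
    obtain ⟨h, hh, rfl⟩ := List.mem_map.1 hx
    exact ⟨h, List.mem_range.1 hh, rfl⟩
  obtain ⟨p, hp⟩ := exists_entries_eq (m := m) (d := d)
    (by
      rw [hd, List.pairwise_map]
      refine List.pairwise_lt_range.imp fun {x y} hxy => ?_
      refine Nat.sub_le_sub_right (Finset.card_le_card fun i hi => ?_) _
      simp at hi ⊢
      omega)
    (fun x hx => by
      obtain ⟨h, hh, rfl⟩ := hmem x hx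
      have := hlow h hh
      omega)
    (by
      have h1 := hT.sum_eq
      rw [ha.1, hd, List.length_map, List.length_range] at h1
      exact (Nat.add_right_cancel h1).symm)
  refine ⟨p, mem_partitionsLE.2 fun x hx => ?_, by rwa [hp]⟩
  rw [hp] at hx
  obtain ⟨h, -, rfl⟩ := hmem x hx
  have := hup h
  omega

theorem sum_hasType (hcs : c < s) (hm : 0 < m) {p : m.Partition} (hp : p ∈ partitionsLE c m)
    {i : ℕ} : ∑ a ∈ typeSet (s - c) (Finset.univ : Finset (Fin s)) (entries p),
      (linSet a).card.choose (i - 1) =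
      chainProd s c (entries p) ((entries p).length - 1) *
        Acoeff s c i (entries p) ((entries p).length - 1) := by
  have hd := entries_ne_nil hm p
  rw [chainProd_eq_prod_range, Acoeff, ← sum_typeSet_choose (s := s) (N := s - c) (c := c)
    (by omega) (by omega) (entries p) hd c le_rfl (pairwise_cons_entries hp) Finset.univ
    (by simp; omega)]
  refine Finset.sum_congr rfl fun a ha => ?_
  rw [linSet_eq_linSetIn, topExp_of_hasType (mem_typeSet.1 ha).2 hd (by omega)]

theorem sum_gens_eq_sum_partitions (hcs : c < s) (hm : 0 < m) (i t : ℕ) :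
    ∑ a ∈ (gens s c m).filter (fun a => topExp a = t), (linSet a).card.choose (i - 1) =
      ∑ p ∈ (partitionsLE c m).filter (fun p => (entries p).length = t),
        chainProd s c (entries p) (t - 1) * Acoeff s c i (entries p) (t - 1) := by
  classical
  have hN : 0 < s - c := by omega
  have hex : ∀ a : Fin s → ℕ, ∃ p : m.Partition, a ∈ gens s c m →
      p ∈ partitionsLE c m ∧ HasType (s - c) (entries p) a := by
    intro a
    by_cases ha : a ∈ gens s c m
    · obtain ⟨p, hp, hT⟩ := (mem_gens.1 ha).exists_hasType hcs
      exact ⟨p, fun _ => ⟨hp, hT⟩⟩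
    · exact ⟨default, fun h => absurd h ha⟩
  choose P hP using hex
  rw [← Finset.sum_fiberwise_of_maps_to (g := P)
    (t := (partitionsLE c m).filter fun p => (entries p).length = t)]
  · refine Finset.sum_congr rfl fun p hp => ?_
    obtain ⟨hp, ht⟩ := Finset.mem_filter.1 hp
    rw [← ht, ← sum_hasType hcs hm hp]
    refine Finset.sum_congr ?_ fun _ _ => rfl
    ext a
    rw [Finset.mem_filter, Finset.mem_filter, mem_typeSet]
    constructor
    · rintro ⟨⟨ha, -⟩, rfl⟩
      exact ⟨fun i hi => absurd (Finset.mem_univ i) hi, (hP a ha).2⟩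
    · rintro ⟨-, hT⟩
      have ha : a ∈ gens s c m := mem_gens.2 (isGen_of_hasType hcs hm hT)
      exact ⟨⟨ha, topExp_of_hasType hT (entries_ne_nil hm p) hN⟩,
        entries_injective ((hP a ha).2.unique hN hT)⟩
  · intro a ha
    obtain ⟨ha, ht⟩ := Finset.mem_filter.1 ha
    obtain ⟨h1, h2⟩ := hP a ha
    rw [Finset.mem_filter]
    exact ⟨h1, by rw [← topExp_of_hasType h2 (entries_ne_nil hm _) hN, ht]⟩

variable {q r : ℕ}

/-- The factors between the two indices are `C(x, x) = 1`, because the entries are constant there.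
-/
theorem chainProd_overlapIndex (hm : 0 < m) (hqr : m = q * c + r) (hr : 1 ≤ r) (hrc : r ≤ c)
    {p : m.Partition} (hp : p ∈ partitionsLE c m)
    (hne : entries p ≠ List.replicate q c ++ [r]) :
    chainProd s c (entries p) (overlapIndex c p) =
      chainProd s c (entries p) ((entries p).length - 1) := by
  obtain ⟨hle, hconst⟩ := overlapIndex_spec hm hqr hr hrc hp hne
  rw [chainProd_eq_prod_range, chainProd_eq_prod_range, ← Finset.prod_range_mul_prod_Ico _ hle,
    Finset.prod_eq_one (s := Finset.Ico _ _), mul_one]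
  intro h hh
  rw [Finset.mem_Ico] at hh
  rw [hconst h hh.1 (by omega), hconst (h + 1) (by omega) (by omega), Nat.choose_self]

theorem entry_overlapIndex (hm : 0 < m) (hqr : m = q * c + r) (hr : 1 ≤ r) (hrc : r ≤ c)
    {p : m.Partition} (hp : p ∈ partitionsLE c m)
    (hne : entries p ≠ List.replicate q c ++ [r]) :
    entry c (entries p) (overlapIndex c p) = entry c (entries p) ((entries p).length - 1) := by
  obtain ⟨hle, hconst⟩ := overlapIndex_spec hm hqr hr hrc hp hne
  exact hconst _ le_rfl hle

theorem entry_replicate_append {h : ℕ} (hh : h ≤ q) :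
    entry c (List.replicate q c ++ [r]) h = c := by
  rw [entry_append _ (by simpa using hh)]
  cases h with
  | zero => rfl
  | succ h =>
    rw [entry_succ, List.getD_eq_getElem _ _ (by simp; omega), List.getElem_replicate]

theorem entry_replicate_append_last : entry c (List.replicate q c ++ [r]) (q + 1) = r := by
  rw [entry_succ, List.getD_append_right _ _ _ _ (by simp)]
  simp

/-- The largest partition has no index of overlap, but the count with index `t - 1 = q` still
applies to it. -/
theorem maximal_term (hcs : c < s) (hr : 1 ≤ r) (hrc : r ≤ c) {i : ℕ} (hi : 1 ≤ i) :
    chainProd s c (List.replicate q c ++ [r]) q * Acoeff s c i (List.replicate q c ++ [r]) q =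
      topTerm s c r i := by
  have h1 : chainProd s c (List.replicate q c ++ [r]) q = 1 := by
    rw [chainProd_eq_prod_range]
    refine Finset.prod_eq_one fun h hh => ?_
    rw [Finset.mem_range] at hh
    rw [entry_replicate_append hh.le, entry_replicate_append hh, Nat.choose_self]
  have hlen : (List.replicate q c ++ [r]).length = q + 1 := by simp
  rw [h1, one_mul, Acoeff, hlen, entry_replicate_append le_rfl, entry_replicate_append_last,
    topTerm]
  have h2 : ∀ j, (c - c + j).choose (i - 1) * (s - c + r + j - 1).choose j =
      j.choose (i - 1) * ((s - c + r - 1) + j).choose j := by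
    intro j
    rw [show c - c + j = j by omega, show s - c + r + j - 1 = (s - c + r - 1) + j by omega]
  simp_rw [h2]
  rw [sum_choose_mul_choose]
  by_cases h : i ≤ c - r + 1
  · rw [if_pos h, if_pos (by omega), show s - c + r - 1 + (c - r) + 1 = s by omega,
      show c - r - (i - 1) = c - r + 1 - i by omega,
      show s - c + r - 1 + (i - 1) = s - c + r + i - 2 by omega]
  · rw [if_neg h, if_neg (by omega)]

theorem ceilDiv_eq (hqr : m = q * c + r) (hr : 1 ≤ r) (hrc : r ≤ c) : m ⌈/⌉ c = q + 1 := by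
  rw [Nat.ceilDiv_eq_add_pred_div, hqr,
    show q * c + r + c - 1 = (r - 1) + c * (q + 1) by rw [mul_add, mul_comm q c]; omega,
    Nat.add_mul_div_left _ _ (by omega), Nat.div_eq_of_lt (by omega), zero_add]

/-- The weighted count of the generators in terms of partitions and their overlap indices. -/
theorem sum_gens_eq (hcs : c < s) (hm : 0 < m) (hqr : m = q * c + r) (hr : 1 ≤ r)
    (hrc : r ≤ c) {i : ℕ} (hi : 1 ≤ i) (t : ℕ) :
    ∑ a ∈ (gens s c m).filter (fun a => topExp a = t), (linSet a).card.choose (i - 1) =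
      (∑ p ∈ (nonmaximalPartitions c m q r t).filter
            (fun p => entry c (entries p) t = entry c (entries p) (overlapIndex c p)),
          (c - entry c (entries p) (overlapIndex c p)).choose (i - 1) *
            chainProd s c (entries p) (overlapIndex c p))
        + (∑ p ∈ (nonmaximalPartitions c m q r t).filter
            (fun p => entry c (entries p) t < entry c (entries p) (overlapIndex c p)),
          chainProd s c (entries p) (overlapIndex c p) *
            Acoeff s c i (entries p) (overlapIndex c p))
        + (if t = m ⌈/⌉ c then topTerm s c r i else 0) := by
  rw [sum_gens_eq_sum_partitions hcs hm,
    ← Finset.sum_filter_add_sum_filter_not _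
      (fun p : m.Partition => entries p ≠ List.replicate q c ++ [r])]
  have hfilt : ((partitionsLE c m).filter fun p => (entries p).length = t).filter
      (fun p => entries p ≠ List.replicate q c ++ [r]) = nonmaximalPartitions c m q r t := by
    rw [Finset.filter_filter]; rfl
  rw [hfilt]
  congr 1
  · rw [← Finset.sum_filter_add_sum_filter_not (nonmaximalPartitions c m q r t)
      (fun p => entry c (entries p) t = entry c (entries p) (overlapIndex c p))]
    have hspec : ∀ p ∈ nonmaximalPartitions c m q r t, p ∈ partitionsLE c m ∧
        (entries p).length = t ∧ entries p ≠ List.replicate q c ++ [r] := fun p hp =>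
      Finset.mem_filter.1 hp
    have hA : ∀ p ∈ nonmaximalPartitions c m q r t,
        Acoeff s c i (entries p) (overlapIndex c p) = Acoeff s c i (entries p) (t - 1) := by
      intro p hp
      obtain ⟨h1, h2, h3⟩ := hspec p hp
      rw [Acoeff, Acoeff, entry_overlapIndex hm hqr hr hrc h1 h3, h2]
    have hB : ∀ p ∈ nonmaximalPartitions c m q r t,
        chainProd s c (entries p) (overlapIndex c p) = chainProd s c (entries p) (t - 1) := by
      intro p hp
      obtain ⟨h1, h2, h3⟩ := hspec p hp
      rw [chainProd_overlapIndex hm hqr hr hrc h1 h3, h2]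
    congr 1
    -- When `d_t = d_{i₀}`, the sum `A_{i-1}` has the single term `j = 0`, so both sums of the
    -- formula are instances of one expression.
    · refine Finset.sum_congr rfl fun p hp => ?_
      obtain ⟨hp, heq⟩ := Finset.mem_filter.1 hp
      rw [← hA p hp, ← hB p hp, mul_comm]
      congr 1
      rw [Acoeff, (hspec p hp).2.1, heq, Nat.sub_self]
      simp
    · refine Finset.sum_congr ?_ fun p hp => ?_
      · refine Finset.filter_congr fun p hp => ?_
        obtain ⟨h1, h2, h3⟩ := hspec p hp
        have hanti := entry_antitone (pairwise_cons_entries h1)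
        have hle : entry c (entries p) t ≤ entry c (entries p) (overlapIndex c p) := by
          rw [entry_overlapIndex hm hqr hr hrc h1 h3]
          exact hanti (by omega)
        exact ⟨fun h => lt_of_le_of_ne hle h, fun h => h.ne⟩
      · have hp := (Finset.mem_filter.1 hp).1
        rw [hA p hp, hB p hp]
  · rw [ceilDiv_eq hqr hr hrc]
    obtain ⟨p₀, hp₀⟩ := exists_entries_eq (m := m) (d := List.replicate q c ++ [r])
      (by
        rw [List.pairwise_append]
        refine ⟨List.pairwise_replicate.2 (Or.inr le_rfl), List.pairwise_singleton _ _, ?_⟩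
        intro x hx y hy
        rw [List.eq_of_mem_replicate hx, List.mem_singleton.1 hy]
        exact hrc)
      (fun x hx => by
        rcases List.mem_append.1 hx with h | h
        · rw [List.eq_of_mem_replicate h]; omega
        · rw [List.mem_singleton.1 h]; omega)
      (by simp [hqr])
    have hmem₀ : p₀ ∈ partitionsLE c m := mem_partitionsLE.2 fun x hx => by
      rw [hp₀] at hx
      rcases List.mem_append.1 hx with h | h
      · rw [List.eq_of_mem_replicate h]
      · rw [List.mem_singleton.1 h]; exact hrc
    have hlen : (entries p₀).length = q + 1 := by rw [hp₀]; simp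
    have huniq : ∀ p : m.Partition, entries p = List.replicate q c ++ [r] → p = p₀ := fun p h =>
      entries_injective (h.trans hp₀.symm)
    split_ifs with ht
    · have : ((partitionsLE c m).filter fun p => (entries p).length = t).filter
          (fun p => ¬ entries p ≠ List.replicate q c ++ [r]) = {p₀} := by
        ext p
        rw [Finset.mem_filter, Finset.mem_filter, Finset.mem_singleton, not_not]
        constructor
        · exact fun h => huniq p h.2
        · rintro rfl
          exact ⟨⟨hmem₀, hlen.trans ht.symm⟩, hp₀⟩
      rw [this, Finset.sum_singleton, ht, Nat.add_sub_cancel, hp₀, maximal_term hcs hr hrc hi]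
    · refine Finset.sum_eq_zero fun p hp => absurd ?_ ht
      rw [Finset.mem_filter, Finset.mem_filter, not_not] at hp
      rw [← hp.1.2, huniq p hp.2, hlen]

end Formula

/-- A constant form is either zero, which is not regular, or a unit, which generates the whole ring;
both contradict regularity of the sequence. -/
theorem degree_pos {k : Type*} [Field k] {n s c δ : ℕ} (hcs : c < s)
    {F : Fin s → MvPolynomial (Fin (n + 1)) k} (hF : ∀ j, (F j).IsHomogeneous δ)
    (hreg : ∀ e : Fin (c + 1) ↪ Fin s,
      RingTheory.Sequence.IsRegular (MvPolynomial (Fin (n + 1)) k)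
        (List.ofFn fun a => F (e a))) : 0 < δ := by
  by_contra h0
  obtain rfl : δ = 0 := by omega
  let e : Fin (c + 1) ↪ Fin s := Fin.castLEEmb (by omega)
  have hconst := MvPolynomial.totalDegree_eq_zero_iff_eq_C.1
    (Nat.le_zero.1 (hF (e 0)).totalDegree_le)
  by_cases hz : F (e 0) = 0
  · have := regularUpTo_of_isRegular hcs hreg ∅ (by simp) (e 0) (by simp) 1 (by simp [hz])
    simp at this
  · have hunit : IsUnit (F (e 0)) := by
      rw [hconst]
      refine IsUnit.map MvPolynomial.C (isUnit_iff_ne_zero.2 fun h => hz ?_)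
      rw [hconst, h, map_zero]
    refine (hreg e).top_ne_smul ?_
    have hmem : F (e 0) ∈ Ideal.ofList (List.ofFn fun a => F (e a)) :=
      Ideal.subset_span (by simp)
    rw [Ideal.eq_top_of_isUnit_mem _ hmem hunit]
    simp

end StarConfiguration

open StarConfiguration in
theorem theorem7 {k : Type*} [Field k] (n s c δ m q r : ℕ)
    (hc : 1 ≤ c) (hcs : c < s)
    (F : Fin s → MvPolynomial (Fin (n + 1)) k)
    (hF : ∀ j, (F j).IsHomogeneous δ)
    (hreg : ∀ e : Fin (c + 1) ↪ Fin s,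
      RingTheory.Sequence.IsRegular (MvPolynomial (Fin (n + 1)) k)
        (List.ofFn fun a => F (e a)))
    (hm : 1 < m) (hqr : m = q * c + r) (hr : 1 ≤ r) (hrc : r ≤ c) :
    Nonempty (MinimalGradedFreeResolution (symbolicPower (starIdeal c F) m)) ∧
    ∀ G : MinimalGradedFreeResolution (symbolicPower (starIdeal c F) m),
    ∀ i t : ℕ, 1 ≤ i → i ≤ c → m ⌈/⌉ c ≤ t → t ≤ m →
      G.betti i (δ * (t * (s - c) + m + i - 1)) =
        (∑ p ∈ (nonmaximalPartitions c m q r t).filter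
            (fun p => entry c (entries p) t = entry c (entries p) (overlapIndex c p)),
          (c - entry c (entries p) (overlapIndex c p)).choose (i - 1) *
            chainProd s c (entries p) (overlapIndex c p))
        + (∑ p ∈ (nonmaximalPartitions c m q r t).filter
            (fun p => entry c (entries p) t < entry c (entries p) (overlapIndex c p)),
          chainProd s c (entries p) (overlapIndex c p) *
            Acoeff s c i (entries p) (overlapIndex c p))
        + (if t = m ⌈/⌉ c then topTerm s c r i else 0) := by
  have hreg' := regularUpTo_of_isRegular hcs hreg
  have hδ := degree_pos hcs hF hreg
  rw [symbolicPower_starIdeal hcs hm.le hreg', monIdeal_symExp hcs hm.le]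
  obtain ⟨C, hC⟩ := exists_resolution_gens hcs hm.le hreg' hF hδ
  refine ⟨⟨C⟩, fun G i t hi _ _ _ => ?_⟩
  obtain ⟨l, rfl⟩ : ∃ l, i = l + 1 := ⟨i - 1, by omega⟩
  rw [← sum_gens_eq hcs (by omega) hqr hr hrc hi t,
    G.betti_eq C (isHomogeneous_monIdeal hF _), hC, Finset.sum_filter]
  refine Finset.sum_congr rfl fun a ha => ?_
  -- As `δ` and `s - c` are positive, the internal degree determines the largest exponent, so only
  -- generators with maximum `t` contribute.
  have hdeg : δ * (t * (s - c) + m + (l + 1) - 1) = δ * (∑ i, a i + l) ↔ topExp a = t := by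
    rw [(mem_gens.1 ha).1, Nat.mul_right_inj hδ.ne',
      show t * (s - c) + m + (l + 1) - 1 = t * (s - c) + m + l by omega]
    constructor
    · intro h
      exact (Nat.eq_of_mul_eq_mul_right (show 0 < s - c by omega)
        (show t * (s - c) = topExp a * (s - c) by omega)).symm
    · rintro rfl
      omega
  simp only [hdeg, Nat.add_sub_cancel]
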